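/- An alternating sign matrix (ASM) is a square matrix with entries in $\{0,1,-1\}$ such that in each row and in each column there is a nonzero entry, the nonzero entries alternate between $1$ and $-1$, and the first and last nonzero entries are $1$. For $n\ge 1$ let $A(n;x)=\sum_M x^{k(M)}$, where $M$ runs over all $n\times n$ ASMs and $k(M)$ is the number of entries of $M$ equal to $-1$. Then there is a sequence of polynomials $B(1;x),B(2;x),B(3;x),\dots$ with integer coefficients such that, for every $n\ge 1$, $$A(n;x)=B(n;x)\,B(n+1;x)\quad\text{if } n \text{ is odd},$$ $$A(n;x)=2\,B(n;x)\,B(n+1;x)\quad\text{if } n \text{ is even}.$$ -/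

import Mathlib

open Polynomial

/-- A finite sequence of integers is an alternating sign sequence if its entries are `0`, `1`
or `-1`, not all entries are zero, any two consecutive nonzero entries (those with only zeros
between them) have opposite signs, and the first and the last nonzero entry are equal to `1`. -/
structure IsAlternatingSign {n : ℕ} (v : Fin n → ℤ) : Prop where
  entries : ∀ i, v i = -1 ∨ v i = 0 ∨ v i = 1
  exists_ne_zero : ∃ i, v i ≠ 0
  alternate : ∀ i j, i < j → v i ≠ 0 → v j ≠ 0 → (∀ k, i < k → k < j → v k = 0) → v j = -v i
  first : ∀ i, v i ≠ 0 → (∀ k, k < i → v k = 0) → v i = 1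
  last : ∀ i, v i ≠ 0 → (∀ k, i < k → v k = 0) → v i = 1

/-- An alternating sign matrix: every row and every column is an alternating sign sequence. -/
structure IsASM {n : ℕ} (M : Matrix (Fin n) (Fin n) ℤ) : Prop where
  row : ∀ i, IsAlternatingSign (fun j => M i j)
  col : ∀ j, IsAlternatingSign (fun i => M i j)

theorem finite_setOf_isASM (n : ℕ) : {M : Matrix (Fin n) (Fin n) ℤ | IsASM M}.Finite := by
  have h : (Set.univ.pi fun _ : Fin n => Set.univ.pi fun _ : Fin n =>
      ({-1, 0, 1} : Set ℤ)).Finite :=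
    Set.Finite.pi fun _ => Set.Finite.pi fun _ => Set.toFinite _
  refine h.subset fun M hM => ?_
  intro i _ j _
  simpa using (hM.row i).entries j

/-- The finite set of all `n × n` alternating sign matrices. -/
noncomputable def asmFinset (n : ℕ) : Finset (Matrix (Fin n) (Fin n) ℤ) :=
  (finite_setOf_isASM n).toFinset

theorem mem_asmFinset {n : ℕ} (M : Matrix (Fin n) (Fin n) ℤ) :
    M ∈ asmFinset n ↔ IsASM M :=
  (finite_setOf_isASM n).mem_toFinset

/-- The number of entries of `M` that are equal to `-1`. -/
def negOneCount {n : ℕ} (M : Matrix (Fin n) (Fin n) ℤ) : ℕ :=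
  (Finset.univ.filter fun p : Fin n × Fin n => M p.1 p.2 = -1).card

/-- The `x`-enumeration of `n × n` alternating sign matrices, as a polynomial in `x`: a matrix
with exactly `k` entries equal to `-1` has weight `x ^ k`. -/
noncomputable def asmEnum (n : ℕ) : ℤ[X] :=
  ∑ M ∈ asmFinset n, X ^ negOneCount M

/-! Partial sums along rows and columns turn alternating sign matrices into states of the six-vertex
model with domain wall boundary. The weights depend on a parameter `s` for each row and `t` for each
column; at `s = t = 0` an entry `-1` weighs `x = -4g²` and every other entry weighs `1`, so the
partition function becomes A(n;x) (`partition_zero_eq_aeval`). The Yang–Baxter equation makes the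
partition function symmetric in the row parameters, and this leads to the Izergin–Korepin formula:
up to explicit factors it is the determinant of the kernel `1 / den g s t` (`partition_eq_det`).

The factorization comes from `den g (-s) (-t) = den g s t`: the kernel is a part even in both
variables plus a part odd in both. Give rows and columns the same nodes, closed under negation and
containing 0 when n is odd. Then the determinant splits into an even one of size k = ⌈n/2⌉ and an
odd one of size m = ⌊n/2⌋ (`partition_symm`). As the nodes tend to 0, each becomes a determinant of
power series coefficients in u = s²/(1 - (1+g²)s²) (`tendsto_det_kernel`), depending only on its
size and on x.

Passing from n to n + 1 enlarges only one of the two determinants, so consecutive A(n;x) share a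
factor: B(2m) comes from the even kernel of size m, B(2m+1) from the odd kernel of size m. The limit
is taken for real g > 0; infinitely many values of x then give the polynomial identity
(`asmEnum_eq`). -/

namespace SixVertex

/-! ### Six-vertex weights and the Yang–Baxter equation -/

/-- The `a`-weight. -/
def wa {F : Type*} [CommRing F] (g s t : F) : F := 1 - (1 + g ^ 2) * s * t + g * (s - t)

/-- The `b`-weight. -/
def wb {F : Type*} [CommRing F] (g s t : F) : F := 1 - (1 + g ^ 2) * s * t - g * (s - t)

/-- Weight of a vertex with left, top, right and bottom edges `h`, `σ`, `h'`, `τ`. -/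
def vertex {F : Type*} [CommRing F] (g s t : F) : Bool → Bool → Bool → Bool → F
  | false, false, false, false => wa g s t
  | true, true, true, true => wa g s t
  | false, true, false, true => wb g s t
  | true, false, true, false => wb g s t
  | false, false, true, true => 1 - (1 + g ^ 2) * s ^ 2
  | true, true, false, false => -4 * g ^ 2 * (1 - (1 + g ^ 2) * t ^ 2)
  | _, _, _, _ => 0

/-- Weight of a row whose left edge is `h` and whose right edge is `true`. -/
def row {F : Type*} [CommRing F] (g s : F) :
    (n : ℕ) → (Fin n → F) → Bool → (Fin n → Bool) → (Fin n → Bool) → F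
  | 0, _, h, _, _ => if h = true then 1 else 0
  | n + 1, t, h, σ, τ => ∑ k, vertex g s (t 0) h (σ 0) k (τ 0) *
      row g s n (Fin.tail t) k (Fin.tail σ) (Fin.tail τ)

/-- Weight of two consecutive rows. -/
def twoRow {F : Type*} [CommRing F] (g s s' : F) (n : ℕ) (t : Fin n → F) (h h' : Bool)
    (σ ρ : Fin n → Bool) : F :=
  ∑ τ : Fin n → Bool, row g s n t h σ τ * row g s' n t h' τ ρ

theorem sum_fun_succ {F : Type*} [AddCommMonoid F] {n : ℕ} (f : (Fin (n + 1) → Bool) → F) :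
    ∑ τ, f τ = ∑ b : Bool, ∑ τ : Fin n → Bool, f (Fin.cons b τ) := by
  rw [← Fintype.sum_prod_type', ← (Fin.consEquiv fun _ : Fin (n + 1) => Bool).sum_comp]
  rfl

theorem twoRow_succ {F : Type*} [CommRing F] (g s s' : F) (n : ℕ) (t : Fin (n + 1) → F)
    (h h' : Bool) (σ ρ : Fin (n + 1) → Bool) :
    twoRow g s s' (n + 1) t h h' σ ρ = ∑ k, ∑ k',
      (∑ b, vertex g s (t 0) h (σ 0) k b * vertex g s' (t 0) h' b k' (ρ 0)) *
        twoRow g s s' n (Fin.tail t) k k' (Fin.tail σ) (Fin.tail ρ) := by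
  simp only [twoRow, sum_fun_succ, row, Fin.cons_zero, Fin.tail_cons, Finset.sum_mul,
    Finset.mul_sum]
  rw [Finset.sum_comm]
  simp only [Fintype.sum_bool, Finset.sum_add_distrib]
  simp only [mul_assoc, mul_left_comm]
  ring

/-- The intertwiner of the Yang–Baxter equation. -/
def intertwiner {F : Type*} [CommRing F] (g s s' : F) : Bool → Bool → Bool → Bool → F
  | false, false, false, false => -2 * g * (1 - (1 + g ^ 2) * s * s') + (1 + 2 * g ^ 2) * (s - s')
  | true, true, true, true => -2 * g * (1 - (1 + g ^ 2) * s * s') + (1 + 2 * g ^ 2) * (s - s')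
  | false, true, false, true => -2 * g * (1 - (1 + g ^ 2) * s' ^ 2)
  | true, false, true, false => -2 * g * (1 - (1 + g ^ 2) * s ^ 2)
  | false, true, true, false => s - s'
  | true, false, false, true => s - s'
  | _, _, _, _ => 0

set_option maxHeartbeats 2000000 in
theorem yangBaxter {F : Type*} [CommRing F] (g s s' t : F) (h h' k k' σ ρ : Bool) :
    ∑ i, ∑ i', intertwiner g s s' h h' i i' *
      ∑ b, vertex g s t i σ k b * vertex g s' t i' b k' ρ =
    ∑ i, ∑ i', (∑ b, vertex g s' t h σ i b * vertex g s t h' b i' ρ) *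
      intertwiner g s s' i i' k k' := by
  cases h <;> cases h' <;> cases k <;> cases k' <;> cases σ <;> cases ρ <;>
    simp only [Fintype.sum_bool, vertex, intertwiner, wa, wb, mul_zero, zero_mul, add_zero,
      zero_add] <;> ring

/-- The Yang–Baxter equation pushes the intertwiner through the two rows one column at a time. It
leaves on the right, where both edges are `true` and it acts as a scalar. -/
theorem intertwiner_twoRow {F : Type*} [CommRing F] (g s s' : F) (n : ℕ) (t : Fin n → F)
    (h h' : Bool) (σ ρ : Fin n → Bool) :
    ∑ i, ∑ i', intertwiner g s s' h h' i i' * twoRow g s s' n t i i' σ ρ =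
      intertwiner g s s' true true true true * twoRow g s' s n t h h' σ ρ := by
  induction n generalizing h h' with
  | zero =>
    cases h <;> cases h' <;> simp [twoRow, row, intertwiner]
  | succ n ih =>
    have key := fun k k' => yangBaxter g s s' (t 0) h h' k k' (σ 0) (ρ 0)
    calc _ = ∑ k, ∑ k', (∑ i, ∑ i', intertwiner g s s' h h' i i' *
          ∑ b, vertex g s (t 0) i (σ 0) k b * vertex g s' (t 0) i' b k' (ρ 0)) *
            twoRow g s s' n (Fin.tail t) k k' (Fin.tail σ) (Fin.tail ρ) := by
          simp only [twoRow_succ, Fintype.sum_bool]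
          ring
      _ = ∑ i, ∑ i', (∑ b, vertex g s' (t 0) h (σ 0) i b * vertex g s (t 0) h' b i' (ρ 0)) *
            ∑ k, ∑ k', intertwiner g s s' i i' k k' *
              twoRow g s s' n (Fin.tail t) k k' (Fin.tail σ) (Fin.tail ρ) := by
          simp only [key]
          simp only [Fintype.sum_bool]
          ring
      _ = _ := by
          simp only [ih]
          simp only [twoRow_succ, Fintype.sum_bool]
          ring

/-- With both left edges `false` the intertwiner is the same scalar on the left as on the right, and
it cancels. -/
theorem twoRow_comm {F : Type*} [Field F] {g s s' : F}
    (hρ : -2 * g * (1 - (1 + g ^ 2) * s * s') + (1 + 2 * g ^ 2) * (s - s') ≠ 0)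
    (n : ℕ) (t : Fin n → F) (σ ρ : Fin n → Bool) :
    twoRow g s s' n t false false σ ρ = twoRow g s' s n t false false σ ρ := by
  have h := intertwiner_twoRow g s s' n t false false σ ρ
  simp only [Fintype.sum_bool, intertwiner, zero_mul, zero_add] at h
  exact mul_left_cancel₀ hρ h

/-- Partition function of a rectangle with rows `l`, columns `t`, top edges `σ`, all bottom
edges `true`, all left edges `false` and all right edges `true`. -/
def partition {F : Type*} [CommRing F] (g : F) {n : ℕ} (t : Fin n → F) :
    List F → (Fin n → Bool) → F
  | [], σ => if σ = fun _ => true then 1 else 0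
  | s :: l, σ => ∑ τ, row g s n t false σ τ * partition g t l τ

theorem partition_perm {F : Type*} [Field F] {g : F} {n : ℕ} (t : Fin n → F) {l l' : List F}
    (hl : l.Perm l') (hρ : ∀ s ∈ l, ∀ s' ∈ l,
      -2 * g * (1 - (1 + g ^ 2) * s * s') + (1 + 2 * g ^ 2) * (s - s') ≠ 0)
    (σ : Fin n → Bool) : partition g t l σ = partition g t l' σ := by
  induction hl generalizing σ with
  | nil => rfl
  | cons s h ih =>
    simp only [partition]
    refine Finset.sum_congr rfl fun τ _ => ?_
    rw [ih fun a ha b hb => hρ a (List.mem_cons_of_mem _ ha) b (List.mem_cons_of_mem _ hb)]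
  | swap s s' l =>
    have key : ∀ a b, partition g t (a :: b :: l) σ =
        ∑ ρ, twoRow g a b n t false false σ ρ * partition g t l ρ := by
      intro a b
      simp only [partition, Finset.mul_sum, twoRow, Finset.sum_mul]
      rw [Finset.sum_comm]
      simp only [mul_assoc]
    rw [key, key]
    refine Finset.sum_congr rfl fun ρ _ => ?_
    rw [twoRow_comm (hρ s' (by simp) s (by simp))]
  | trans h h' ih ih' =>
    rw [ih hρ, ih' fun a ha b hb => hρ a (h.mem_iff.2 ha) b (h.mem_iff.2 hb)]

/-! ### The first column -/

theorem row_cons_true {F : Type*} [CommRing F] (g s t₀ : F) {n : ℕ} (t : Fin n → F)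
    (σ τ : Fin n → Bool) (b : Bool) :
    row g s (n + 1) (Fin.cons t₀ t) false (Fin.cons true σ) (Fin.cons b τ) =
      if b = true then wb g s t₀ * row g s n t false σ τ else 0 := by
  cases b <;> simp [row, vertex]

/-- A `true` edge on top and a `false` edge on the left force a `b`-vertex, which again has `true`
below; so the whole column freezes. -/
theorem partition_cons_true {F : Type*} [CommRing F] (g t₀ : F) {n : ℕ} (t : Fin n → F)
    (l : List F) (σ : Fin n → Bool) :
    partition g (Fin.cons t₀ t : Fin (n + 1) → F) l (Fin.cons true σ) =
      (l.map fun s => wb g s t₀).prod * partition g t l σ := by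
  induction l generalizing σ with
  | nil =>
    have : (Fin.cons true σ : Fin (n + 1) → Bool) = (fun _ => true) ↔ σ = fun _ => true := by
      rw [← Fin.cons_self_tail (fun _ : Fin (n + 1) => true), Fin.cons_inj]
      simp [Fin.tail_def]
    simp [partition, this]
  | cons s l ih =>
    simp only [partition, sum_fun_succ, row_cons_true, ih, Fintype.sum_bool, List.map_cons,
      List.prod_cons, Finset.mul_sum, if_true, Bool.false_eq_true, if_false, zero_mul,
      Finset.sum_const_zero, add_zero]
    refine Finset.sum_congr rfl fun τ _ => ?_
    ring

theorem row_true_false {F : Type*} [CommRing F] (g s : F) {n : ℕ} (t : Fin n → F)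
    (τ : Fin n → Bool) :
    row g s n t true (fun _ => false) τ =
      if τ = fun _ => false then ∏ j, wb g s (t j) else 0 := by
  induction n with
  | zero => simp [row]; intro h; exact absurd (Subsingleton.elim _ _) h
  | succ n ih =>
    obtain ⟨b, τ, rfl⟩ : ∃ b τ', τ = Fin.cons b τ' := ⟨τ 0, Fin.tail τ, by simp⟩
    have h1 : Fin.tail (fun _ : Fin (n + 1) => false) = fun _ => false := rfl
    have h2 : (Fin.cons b τ : Fin (n + 1) → Bool) = (fun _ => false) ↔
        b = false ∧ τ = fun _ => false := by
      rw [← Fin.cons_self_tail (fun _ : Fin (n + 1) => false), Fin.cons_inj]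
      simp [Fin.tail_def]
    cases b <;> simp [row, vertex, ih, h1, h2, Fin.prod_univ_succ, Fin.tail_def]

/-- When the corner `a`-weight vanishes, the first row and the first column freeze. -/
theorem partition_corner {F : Type*} [CommRing F] {g s t₀ : F} (h : wa g s t₀ = 0) {n : ℕ}
    (t : Fin n → F) (l : List F) :
    partition g (Fin.cons t₀ t : Fin (n + 1) → F) (s :: l) (fun _ => false) =
      (1 - (1 + g ^ 2) * s ^ 2) * (∏ j, wb g s (t j)) * (l.map fun s => wb g s t₀).prod *
        partition g t l (fun _ => false) := by
  have h1 : Fin.tail (fun _ : Fin (n + 1) => false) = fun _ => false := rfl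
  -- Without its `a`-weight the corner must send `true` both to the right and downwards. To the
  -- right this freezes the row (`row_true_false`), below it freezes the column
  -- (`partition_cons_true`).
  simp only [partition, sum_fun_succ, row, Fin.cons_zero, Fin.tail_cons, Fintype.sum_bool, h1,
    vertex, h, row_true_false, zero_mul, add_zero, Finset.sum_const_zero, partition_cons_true]
  simp
  ring

/-- In the first column all left edges are `false`, so the only vertices are `a`, `b` and the turn
from `false` to `true`. The first two are linear in `t₀`; the turn is free of `t₀` and occurs
exactly once when the column starts at `false`, which saves one degree. -/
theorem partition_polynomial {F : Type*} [Field F] (g : F) {n : ℕ} (t : Fin n → F)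
    (l : List F) (b : Bool) (σ : Fin n → Bool) :
    ∃ p ∈ degreeLT F (l.length + if b then 1 else 0), ∀ t₀,
      partition g (Fin.cons t₀ t : Fin (n + 1) → F) l (Fin.cons b σ) = p.eval t₀ := by
  induction l generalizing b σ with
  | nil =>
    cases b
    · refine ⟨0, Submodule.zero_mem _, fun t₀ => ?_⟩
      have : (Fin.cons false σ : Fin (n + 1) → Bool) ≠ fun _ => true := fun h => by
        simpa using congrFun h 0
      simp [partition, this]
    · refine ⟨C (partition g t [] σ), ?_, fun t₀ => ?_⟩
      · rw [mem_degreeLT]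
        exact degree_C_le.trans_lt (by simp)
      · rw [partition_cons_true]; simp
  | cons s l ih =>
    choose p hp hpe using ih
    have key : ∀ q : F[X], q.natDegree ≤ 1 → ∀ p : F[X], ∀ d : ℕ, p ∈ degreeLT F d →
        q * p ∈ degreeLT F (d + 1) := by
      intro q hq p d hpd
      rw [mem_degreeLT] at *
      rcases eq_or_ne q 0 with rfl | h0
      · simp
      rcases eq_or_ne p 0 with rfl | h0'
      · simp
      rw [degree_mul, degree_eq_natDegree h0, degree_eq_natDegree h0'] at *
      norm_cast at *
      omega
    cases b
    · refine ⟨∑ τ, (C (row g s n t false σ τ) * ((C (1 + g * s) - C (g + (1 + g ^ 2) * s) * X) *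
        p false τ) + C ((1 - (1 + g ^ 2) * s ^ 2) * row g s n t true σ τ) * p true τ), ?_, ?_⟩
      · refine Submodule.sum_mem _ fun τ _ => Submodule.add_mem _ ?_ ?_
        · rw [← smul_eq_C_mul]
          exact Submodule.smul_mem _ _ (key _ (by compute_degree) _ _ (hp false τ))
        · rw [← smul_eq_C_mul]
          exact Submodule.smul_mem _ _ (hp true τ)
      · intro t₀
        simp only [partition, sum_fun_succ, row, Fin.cons_zero, Fin.tail_cons, Fintype.sum_bool,
          vertex, hpe, zero_mul, add_zero, zero_add, ← Finset.sum_add_distrib, eval_finsetSum]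
        refine Finset.sum_congr rfl fun τ _ => ?_
        simp [wa]
        ring
    · refine ⟨∑ τ, C (row g s n t false σ τ) * ((C (1 - g * s) + C (g - (1 + g ^ 2) * s) * X) *
        p true τ), ?_, ?_⟩
      · refine Submodule.sum_mem _ fun τ _ => ?_
        rw [← smul_eq_C_mul]
        exact Submodule.smul_mem _ _ (key _ (by compute_degree) _ _ (hp true τ))
      · intro t₀
        simp only [partition, sum_fun_succ, row_cons_true, Fintype.sum_bool, hpe, if_true,
          Bool.false_eq_true, if_false, zero_mul, Finset.sum_const_zero, add_zero,
          eval_finsetSum]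
        refine Finset.sum_congr rfl fun τ _ => ?_
        simp [wb]
        ring

/-! ### The Izergin–Korepin determinant -/

theorem det_vandermonde_cons {F : Type*} [CommRing F] {n : ℕ} (a : F) (v : Fin n → F) :
    (Matrix.vandermonde (Fin.cons a v : Fin (n + 1) → F)).det =
      (∏ k, (v k - a)) * (Matrix.vandermonde v).det := by
  rw [Matrix.det_vandermonde, Matrix.det_vandermonde, Fin.prod_univ_succ]
  simp

theorem det_vandermonde_succAbove {F : Type*} [CommRing F] {n : ℕ} (v : Fin (n + 1) → F)
    (i : Fin (n + 1)) :
    (Matrix.vandermonde v).det = (-1) ^ (i : ℕ) * ((∏ k, (v (i.succAbove k) - v i)) *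
      (Matrix.vandermonde fun k => v (i.succAbove k)).det) := by
  rw [← det_vandermonde_cons]
  have h : Matrix.vandermonde (Fin.cons (v i) fun k => v (i.succAbove k) : Fin (n + 1) → F) =
      (Matrix.vandermonde v).submatrix i.cycleRange.symm id := by
    ext a b
    simp only [Matrix.vandermonde_apply, Matrix.submatrix_apply, id]
    congr 1
    refine Fin.cases ?_ (fun k => ?_) a <;> simp [Fin.cycleRange_symm_zero, Fin.cycleRange_symm_succ]
  rw [h, Matrix.det_permute, Equiv.Perm.sign_symm, Fin.sign_cycleRange, ← mul_assoc]
  push_cast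
  rw [← mul_pow]
  simp

theorem ofFn_perm_succAbove {α : Type*} {n : ℕ} (s : Fin (n + 1) → α) (i : Fin (n + 1)) :
    (List.ofFn s).Perm (s i :: List.ofFn fun k => s (i.succAbove k)) := by
  have h : (s i :: List.ofFn fun k => s (i.succAbove k)) = List.ofFn (s ∘ i.cycleRange.symm) := by
    simp [List.ofFn_succ, Fin.cycleRange_symm_zero, Fin.cycleRange_symm_succ]
  rw [h]
  exact (Equiv.Perm.ofFn_comp_perm _ s).symm

/-- The inverse of an entry of the Izergin–Korepin matrix. -/
def den {F : Type*} [CommRing F] (g s t : F) : F := wa g s t * wb g s t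

/-- Expansion along the first column. With `d i = den g (s i) t₀`, only that column involves `t₀`,
so the right side is a polynomial in `t₀`. -/
theorem clear_column {F : Type*} [Field F] {n : ℕ} (d : Fin (n + 1) → F) (hd : ∀ i, d i ≠ 0)
    (A : Fin (n + 1) → Fin n → F) :
    (∏ i, d i) * (Matrix.of fun i => (Fin.cons (d i)⁻¹ (A i) : Fin (n + 1) → F)).det =
      ∑ i : Fin (n + 1), (-1) ^ (i : ℕ) * (Matrix.of fun k => A (i.succAbove k)).det *
        ∏ k, d (i.succAbove k) := by
  rw [Matrix.det_succ_column_zero, Finset.mul_sum]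
  refine Finset.sum_congr rfl fun i _ => ?_
  rw [Fin.prod_univ_succAbove d i]
  have : (Matrix.of fun i => (Fin.cons (d i)⁻¹ (A i) : Fin (n + 1) → F)).submatrix i.succAbove
      Fin.succ = Matrix.of fun k => A (i.succAbove k) := by
    ext; simp
  rw [this]
  simp only [Matrix.of_apply, Fin.cons_zero]
  field_simp [hd i]

/-- The Izergin–Korepin determinant formula. -/
theorem partition_eq_det {F : Type*} [Field F] {g : F} {n : ℕ} (s t : Fin n → F)
    (hs : Function.Injective s) (ht : Function.Injective t)
    (ha : ∀ i j, wa g (s i) (t j) ≠ 0) (hb : ∀ i j, wb g (s i) (t j) ≠ 0)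
    (hg : ∀ i, g + (1 + g ^ 2) * s i ≠ 0)
    (hρ : ∀ i j, -2 * g * (1 - (1 + g ^ 2) * s i * s j) + (1 + 2 * g ^ 2) * (s i - s j) ≠ 0) :
    partition g t (List.ofFn s) (fun _ => false) * (Matrix.vandermonde s).det *
        (Matrix.vandermonde t).det =
      (∏ i, (1 - (1 + g ^ 2) * s i ^ 2)) * (∏ i, ∏ j, den g (s i) (t j)) *
        (Matrix.of fun i j => (den g (s i) (t j))⁻¹).det := by
  induction n with
  | zero =>
    have : (fun _ : Fin 0 => false) = fun _ => true := Subsingleton.elim _ _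
    simp [partition, this]
  | succ n ih =>
    obtain ⟨t₀, t, rfl⟩ : ∃ t₀ t', t = Fin.cons t₀ t' := ⟨t 0, Fin.tail t, by simp⟩
    have ha' : ∀ i j, wa g (s i) (t j) ≠ 0 := fun i j => by simpa using ha i j.succ
    have hb' : ∀ i j, wb g (s i) (t j) ≠ 0 := fun i j => by simpa using hb i j.succ
    have hd' : ∀ i j, den g (s i) (t j) ≠ 0 := fun i j => mul_ne_zero (ha' i j) (hb' i j)
    have ht' : Function.Injective t := fun i j h => by
      have := @ht i.succ j.succ (by simpa using h)
      simpa using this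
    obtain ⟨p, hp, hpe⟩ := partition_polynomial g t (List.ofFn s) false fun _ => false
    simp only [List.length_ofFn, Bool.false_eq_true, if_false, add_zero] at hp
    have hcons : (Fin.cons false fun _ => false : Fin (n + 1) → Bool) = fun _ => false := by
      ext j; refine Fin.cases rfl (fun _ => rfl) j
    simp only [hcons] at hpe
    let m : Fin (n + 1) → F := fun i =>
      (Matrix.of fun k j => (den g (s (i.succAbove k)) (t j))⁻¹).det
    let dp : F → F[X] := fun s => (C (1 + g * s) - C (g + (1 + g ^ 2) * s) * X) *
      (C (1 - g * s) + C (g - (1 + g ^ 2) * s) * X)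
    have hdp : ∀ s x, (dp s).eval x = den g s x := fun s x => by
      simp only [dp, den, wa, wb, eval_mul, eval_sub, eval_add, eval_C, eval_X]; ring
    have hdp2 : ∀ s, (dp s).natDegree ≤ 2 := fun s => by
      refine natDegree_mul_le_of_le (m := 1) (n := 1) ?_ ?_ <;> compute_degree
    -- The two sides of the formula as polynomials in `t₀`, with the inverses of column 0 cleared.
    -- Both have degree at most `2 * n`, so agreement at `2 * n + 1` points suffices: the `n` other
    -- column parameters and the `n + 1` zeros `τ i` of the `a`-weights.
    let lp : F[X] := p * ((∏ k, (C (t k) - X)) *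
      C ((Matrix.vandermonde s).det * (Matrix.vandermonde t).det))
    let rp : F[X] := C ((∏ i, (1 - (1 + g ^ 2) * s i ^ 2)) * ∏ i, ∏ j, den g (s i) (t j)) *
      ∑ i : Fin (n + 1), C ((-1) ^ (i : ℕ) * m i) * ∏ k, dp (s (i.succAbove k))
    have hlp : lp.degree < (2 * n + 1 : ℕ) := by
      have h1 : p.natDegree ≤ n := by
        rw [degreeLT_succ_eq_degreeLE, mem_degreeLE] at hp
        exact natDegree_le_of_degree_le hp
      have h2 : ((∏ k, (C (t k) - X)) *
          C ((Matrix.vandermonde s).det * (Matrix.vandermonde t).det)).natDegree ≤ n := by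
        refine (natDegree_mul_C_le _ _).trans ((natDegree_prod_le _ _).trans ?_)
        refine (Finset.sum_le_card_nsmul _ _ 1 fun k _ => ?_).trans (by simp)
        compute_degree
      refine degree_le_natDegree.trans_lt ?_
      norm_cast
      exact Nat.lt_succ_of_le ((natDegree_mul_le_of_le h1 h2).trans (by omega))
    have hrp : rp.degree < (2 * n + 1 : ℕ) := by
      refine degree_le_natDegree.trans_lt ?_
      norm_cast
      refine Nat.lt_succ_of_le ((natDegree_C_mul_le _ _).trans
        (natDegree_sum_le_of_forall_le _ _ fun i _ => (natDegree_C_mul_le _ _).trans ?_))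
      refine (natDegree_prod_le _ _).trans
        ((Finset.sum_le_card_nsmul _ _ 2 fun k _ => hdp2 _).trans ?_)
      simp [mul_comm]
    let τ : Fin (n + 1) → F := fun i => (1 + g * s i) / (g + (1 + g ^ 2) * s i)
    have hτ : ∀ i, wa g (s i) (τ i) = 0 := fun i => by
      have := hg i
      simp only [wa, τ]; field_simp; ring
    -- `τ` is a Möbius function of `s i` with determinant `-1`.
    have hτinj : Function.Injective τ := fun i j h => by
      apply hs
      have hi := hg i
      have hj := hg j
      simp only [τ] at h
      rw [div_eq_div_iff hi hj] at h
      linear_combination -h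
    have hinj : Function.Injective (Sum.elim t τ) := by
      refine ht'.sumElim hτinj fun j i h => ha' i j ?_
      rw [h, hτ]
    -- At `t j` the left side has a vanishing Vandermonde factor and the right side two equal
    -- columns. At `τ i` both sides reduce to size `n`.
    have heval : ∀ i : Fin n ⊕ Fin (n + 1), lp.eval (Sum.elim t τ i) = rp.eval (Sum.elim t τ i) := by
      rintro (j | i)
      · have h0 : lp.eval (t j) = 0 := by
          simp only [lp, eval_mul, eval_prod, eval_sub, eval_C, eval_X]
          rw [Finset.prod_eq_zero (Finset.mem_univ j) (sub_self _)]
          simp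
        have h1 : rp.eval (t j) = 0 := by
          simp only [rp, eval_mul, eval_prod, eval_finsetSum, eval_C, hdp]
          rw [← clear_column (fun i => den g (s i) (t j)) (fun i => hd' i j)
            (fun i j => (den g (s i) (t j))⁻¹),
            Matrix.det_zero_of_column_eq (i := 0) (j := j.succ) (Fin.succ_ne_zero j).symm]
          · simp
          · intro k; simp
        simp [h0, h1]
      · simp only [Sum.elim_inr, lp, rp, eval_mul, eval_prod, eval_sub, eval_finsetSum, eval_C,
          eval_X, hdp, ← hpe]
        -- Symmetry in the rows brings row `i` to the top, where its corner with the first column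
        -- freezes.
        have hZ := partition_perm (Fin.cons (τ i) t : Fin (n + 1) → F) (ofFn_perm_succAbove s i)
          (by
            intro a ha b hb
            obtain ⟨x, rfl⟩ := (List.mem_ofFn' _ _).1 ha
            obtain ⟨y, rfl⟩ := (List.mem_ofFn' _ _).1 hb
            exact hρ x y) fun _ => false
        rw [hZ, partition_corner (hτ i)]
        have ih' := ih (fun k => s (i.succAbove k)) t
          (hs.comp Fin.succAbove_right_injective) ht' (fun _ _ => ha' _ _) (fun _ _ => hb' _ _)
          (fun _ => hg _) (fun _ _ => hρ _ _)
        -- Every term with `x ≠ i` retains the factor `den g (s i) (τ i) = 0`.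
        have hsum : ∑ x : Fin (n + 1), (-1) ^ (x : ℕ) * m x *
            ∏ k, den g (s (x.succAbove k)) (τ i) =
            (-1) ^ (i : ℕ) * m i * ∏ k, den g (s (i.succAbove k)) (τ i) := by
          refine Finset.sum_eq_single i (fun x _ hx => ?_) (fun h => absurd (Finset.mem_univ _) h)
          obtain ⟨k, hk⟩ := Fin.exists_succAbove_eq hx.symm
          rw [Finset.prod_eq_zero (Finset.mem_univ k), mul_zero]
          rw [hk, den, hτ, zero_mul]
        have hprod : (∏ j, wb g (s i) (t j)) * (∏ k, wb g (s (i.succAbove k)) (τ i)) *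
            ((∏ k, (t k - τ i)) * ∏ k, (s (i.succAbove k) - s i)) =
            (∏ j, den g (s i) (t j)) * ∏ k, den g (s (i.succAbove k)) (τ i) := by
          simp only [← Finset.prod_mul_distrib]
          refine Finset.prod_congr rfl fun k _ => ?_
          -- Both `a`-weights are linear and vanish at the point (`s i`, `τ i`); the product of
          -- their slopes, `g + (1 + g ^ 2) * s i` and `g - (1 + g ^ 2) * τ i`, is `-1`.
          have : wa g (s i) (t k) * wa g (s (i.succAbove k)) (τ i) =
              (t k - τ i) * (s (i.succAbove k) - s i) := by
            have := hg i
            simp only [wa, τ]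
            field_simp
            ring
          simp only [den]
          linear_combination (-wb g (s i) (t k) * wb g (s (i.succAbove k)) (τ i)) * this
        rw [hsum, det_vandermonde_succAbove s i,
          Fin.prod_univ_succAbove (fun i => 1 - (1 + g ^ 2) * s i ^ 2) i,
          Fin.prod_univ_succAbove (fun i => ∏ j, den g (s i) (t j)) i, List.map_ofFn,
          List.prod_ofFn]
        simp only [Function.comp_def]
        simp only [m]
        generalize (Matrix.of fun k j => (den g (s (i.succAbove k)) (t j))⁻¹).det = M at *
        generalize (Matrix.vandermonde fun k => s (i.succAbove k)).det = V at *
        generalize (∏ j, wb g (s i) (t j)) = b₁ at *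
        generalize (∏ k, wb g (s (i.succAbove k)) (τ i)) = b₂ at *
        generalize (∏ k, (t k - τ i)) = b₃ at *
        generalize (∏ k, (s (i.succAbove k) - s i)) = b₄ at *
        generalize (∏ j, den g (s i) (t j)) = b₅ at *
        generalize (∏ k, den g (s (i.succAbove k)) (τ i)) = b₆ at *
        linear_combination ((-1) ^ (i : ℕ) * (1 - (1 + g ^ 2) * s i ^ 2) * b₁ * b₂ * b₃ * b₄) * ih' +
          ((-1) ^ (i : ℕ) * (1 - (1 + g ^ 2) * s i ^ 2) * (∏ k, (1 - (1 + g ^ 2) * s (i.succAbove k) ^ 2)) *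
            (∏ k, ∏ j, den g (s (i.succAbove k)) (t j)) * M) * hprod
    have hpoly : lp = rp := by
      refine eq_of_degrees_lt_of_eval_index_eq (Finset.univ (α := Fin n ⊕ Fin (n + 1)))
        (hinj.injOn) ?_ ?_ fun i _ => heval i
      · simpa [two_mul, add_assoc] using hlp
      · simpa [two_mul, add_assoc] using hrp
    have h := congrArg (eval t₀) hpoly
    simp only [lp, rp, eval_mul, eval_prod, eval_sub, eval_finsetSum, eval_C,
          eval_X, hdp, ← hpe] at h
    rw [← clear_column (fun i => den g (s i) t₀)
      (fun i => mul_ne_zero (ha i 0) (hb i 0)) (fun i j => (den g (s i) (t j))⁻¹)] at h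
    rw [det_vandermonde_cons]
    have hm : (Matrix.of fun i j => (den g (s i) ((Fin.cons t₀ t : Fin (n + 1) → F) j))⁻¹) =
        Matrix.of fun i => (Fin.cons (den g (s i) t₀)⁻¹ fun j => (den g (s i) (t j))⁻¹ :
          Fin (n + 1) → F) := by
      ext i j
      refine Fin.cases ?_ (fun k => ?_) j <;> simp
    rw [hm]
    simp only [Fin.prod_univ_succ (fun j => den g _ ((Fin.cons t₀ t : Fin (n + 1) → F) j)),
      Fin.cons_zero, Fin.cons_succ, Finset.prod_mul_distrib]
    linear_combination h

end SixVertex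

/-! ### Alternating sign matrices as six-vertex states -/

theorem isAlternatingSign_iff {n : ℕ} (v : Fin n → ℤ) : IsAlternatingSign v ↔
    (∀ i, v i = -1 ∨ v i = 0 ∨ v i = 1) ∧ (∃ i, v i ≠ 0) ∧
    (∀ i j, i < j → v i ≠ 0 → v j ≠ 0 → (∀ k, i < k → k < j → v k = 0) → v j = -v i) ∧
    (∀ i, v i ≠ 0 → (∀ k, k < i → v k = 0) → v i = 1) ∧
    (∀ i, v i ≠ 0 → (∀ k, i < k → v k = 0) → v i = 1) :=
  ⟨fun ⟨a, b, c, d, e⟩ => ⟨a, b, c, d, e⟩, fun ⟨a, b, c, d, e⟩ => ⟨a, b, c, d, e⟩⟩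

theorem isAlternatingSign_cons_zero {n : ℕ} (v : Fin n → ℤ) :
    IsAlternatingSign (Fin.cons 0 v : Fin (n + 1) → ℤ) ↔ IsAlternatingSign v := by
  simp [isAlternatingSign_iff, Fin.forall_fin_succ, Fin.exists_fin_succ]

theorem isAlternatingSign_cons_one_zero {n : ℕ} (v : Fin n → ℤ) :
    IsAlternatingSign (Fin.cons 1 (Fin.cons 0 v : Fin (n + 1) → ℤ) : Fin (n + 2) → ℤ) ↔
      IsAlternatingSign (Fin.cons 1 v : Fin (n + 1) → ℤ) := by
  simp [isAlternatingSign_iff, Fin.forall_fin_succ, Fin.exists_fin_succ]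

theorem isAlternatingSign_cons_one_neg_one {n : ℕ} (v : Fin n → ℤ) :
    IsAlternatingSign (Fin.cons 1 (Fin.cons (-1) v : Fin (n + 1) → ℤ) : Fin (n + 2) → ℤ) ↔
      IsAlternatingSign v := by
  simp [isAlternatingSign_iff, Fin.forall_fin_succ, Fin.exists_fin_succ]
  have key : ∀ i : Fin n, ¬ i.succ.succ ≤ 1 := fun i h => by
    rw [Fin.le_def] at h; simp at h
  simp only [key, false_implies, implies_true, true_and]
  tauto

namespace SixVertex

/-- The partial sums of `v`, started at `h`, stay in `{0, 1}` and end at `1`. -/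
def Walk : (n : ℕ) → Bool → (Fin n → ℤ) → Prop
  | 0, h, _ => h = true
  | n + 1, h, v => ∃ k : Bool, (k.toNat : ℤ) = h.toNat + v 0 ∧ Walk n k (Fin.tail v)

/-- A running sum of 1 is encoded by prepending a `1`. The lemmas on `Fin.cons` then consume one
entry at a time, in step with the recursion of `Walk`. -/
theorem walk_iff (n : ℕ) (v : Fin n → ℤ) :
    (Walk n false v ↔ IsAlternatingSign v) ∧
      (Walk n true v ↔ IsAlternatingSign (Fin.cons 1 v : Fin (n + 1) → ℤ)) := by
  induction n with
  | zero =>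
    simp [Walk, isAlternatingSign_iff, Fin.forall_fin_succ, Fin.exists_fin_succ]
  | succ n ih =>
    obtain ⟨a, v, rfl⟩ : ∃ a w, v = Fin.cons a w := ⟨v 0, Fin.tail v, by simp⟩
    obtain ⟨ih0, ih1⟩ := ih v
    simp only [Walk, Bool.exists_bool, Fin.cons_zero, Fin.tail_cons, ih0, ih1]
    constructor
    · by_cases h0 : a = 0
      · subst h0; simp [isAlternatingSign_cons_zero]
      by_cases h1 : a = 1
      · subst h1; simp
      · have : ¬ IsAlternatingSign (Fin.cons a v : Fin (n + 1) → ℤ) := fun h =>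
          h1 (h.first 0 (by simpa using h0) (by simp))
        simp [this]; omega
    · by_cases h0 : a = 0
      · subst h0; simp [isAlternatingSign_cons_one_zero]
      by_cases h1 : a = -1
      · subst h1; simp [isAlternatingSign_cons_one_neg_one]
      · have : ¬ IsAlternatingSign
            (Fin.cons 1 (Fin.cons a v : Fin (n + 1) → ℤ) : Fin (n + 2) → ℤ) := fun h =>
          h1 (by
            have := h.alternate 0 1 (by simp) (by simp) (by simpa using h0)
              (fun k h1 h2 => by rw [Fin.lt_def] at h1 h2; simp at h1 h2; omega)
            simpa using this)
        simp [this]; omega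

/-- The entry weight at the homogeneous point. -/
def entryWeight {F : Type*} [One F] (x : F) (a : ℤ) : F := if a = -1 then x else 1

-- The entry at a vertex is its bottom edge minus its top edge, and the allowed vertices are those
-- where the horizontal edge changes by this entry, as in a step of `Walk`. At `s = t = 0` all
-- weights are `1` except that of the entry `-1`.
open Classical in
theorem row_zero {F : Type*} [CommRing F] (g : F) (n : ℕ) (h : Bool) (σ τ : Fin n → Bool) :
    row g 0 n (fun _ => 0) h σ τ =
      if Walk n h (fun j => (τ j).toNat - (σ j).toNat) then
        ∏ j, entryWeight (-4 * g ^ 2) ((τ j).toNat - (σ j).toNat) else 0 := by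
  induction n generalizing h with
  | zero => simp [row, Walk]
  | succ n ih =>
    have h1 : Fin.tail (fun _ : Fin (n + 1) => (0 : F)) = fun _ => 0 := rfl
    simp only [row, h1, ih, Fin.prod_univ_succ, Walk, Fintype.sum_bool, Bool.exists_bool]
    generalize σ 0 = σ0
    generalize τ 0 = τ0
    cases h <;> cases σ0 <;> cases τ0 <;>
      simp [vertex, wa, wb, entryWeight, Fin.tail_def]

open Classical in
/-- Fillings of `k` rows with row walks from `false` and column walks from `σ`. -/
noncomputable def fillings {n : ℕ} : (k : ℕ) → (Fin n → Bool) → Finset (Fin k → Fin n → ℤ)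
  | 0, σ => if σ = fun _ => true then {Fin.elim0} else ∅
  | k + 1, σ => (Finset.univ.filter fun τ : Fin n → Bool =>
      Walk n false fun j => ((τ j).toNat - (σ j).toNat : ℤ)).biUnion fun τ =>
        (fillings k τ).image fun M : Fin k → Fin n → ℤ =>
          (Fin.cons (fun j => ((τ j).toNat - (σ j).toNat : ℤ)) M :
            Fin (k + 1) → Fin n → ℤ)

theorem mem_fillings {n k : ℕ} (σ : Fin n → Bool) (M : Fin k → Fin n → ℤ) :
    M ∈ fillings k σ ↔ (∀ i, Walk n false (M i)) ∧ ∀ j, Walk k (σ j) fun i => M i j := by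
  induction k generalizing σ with
  | zero =>
    simp only [fillings, Walk, IsEmpty.forall_iff, true_and]
    by_cases h : σ = fun _ => true
    · simp [h]; exact Subsingleton.elim _ _
    · simp only [h, if_false, Finset.notMem_empty, false_iff]
      exact fun h' => h (funext h')
  | succ k ih =>
    simp only [fillings, Finset.mem_biUnion, Finset.mem_filter, Finset.mem_univ, true_and,
      Finset.mem_image, ih, Fin.forall_fin_succ, Walk]
    constructor
    · rintro ⟨τ, hτ, M, ⟨hr, hc⟩, rfl⟩
      exact ⟨⟨hτ, hr⟩, fun j => ⟨τ j, by simp, hc j⟩⟩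
    · rintro ⟨⟨h0, hr⟩, hc⟩
      choose τ hτ hc using hc
      have h1 : M 0 = fun j => ((τ j).toNat - (σ j).toNat : ℤ) := by
        ext j; rw [hτ]; simp
      refine ⟨τ, h1 ▸ h0, Fin.tail M, ⟨hr, hc⟩, ?_⟩
      rw [← h1]
      exact Fin.cons_self_tail (α := fun _ => Fin n → ℤ) M

theorem partition_zero {F : Type*} [CommRing F] (g : F) {n : ℕ} (k : ℕ) (σ : Fin n → Bool) :
    partition g (fun _ => 0) (List.replicate k 0) σ =
      ∑ M ∈ fillings k σ, ∏ i, ∏ j, entryWeight (-4 * g ^ 2) (M i j) := by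
  classical
  induction k generalizing σ with
  | zero =>
    by_cases h : σ = fun _ => true <;> simp [partition, fillings, h]
  | succ k ih =>
    simp only [List.replicate_succ, partition, ih, row_zero, fillings, ite_mul, zero_mul]
    rw [← Finset.sum_filter, Finset.sum_biUnion]
    · refine Finset.sum_congr (by congr) fun τ _ => ?_
      rw [Finset.sum_image, Finset.mul_sum]
      · simp [Fin.prod_univ_succ]
      · intro M _ M' _ h
        exact ((Fin.cons_inj (α := fun _ => Fin n → ℤ)).1 h).2
    · intro τ _ τ' _ hne
      rw [Function.onFun, Finset.disjoint_left]
      intro M hM hM'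
      simp only [Finset.mem_image] at hM hM'
      obtain ⟨N, _, rfl⟩ := hM
      obtain ⟨N', _, h⟩ := hM'
      apply hne
      have := ((Fin.cons_inj (α := fun _ => Fin n → ℤ)).1 h).1
      ext j
      have := congrFun this j
      revert this
      cases τ j <;> cases τ' j <;> intro this <;> first | rfl | (simp at this <;> omega)

theorem prod_entryWeight {F : Type*} [CommRing F] (x : F) {n : ℕ} (M : Matrix (Fin n) (Fin n) ℤ) :
    ∏ i, ∏ j, entryWeight x (M i j) = x ^ negOneCount M := by
  rw [← Fintype.prod_prod_type']
  simp [entryWeight, negOneCount, Finset.prod_ite]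

/-- At the homogeneous point the partition function enumerates alternating sign matrices. -/
theorem partition_zero_eq_aeval {F : Type*} [CommRing F] (g : F) (n : ℕ) :
    partition g (fun _ : Fin n => 0) (List.replicate n 0) (fun _ => false) =
      aeval (-4 * g ^ 2) (asmEnum n) := by
  rw [partition_zero]
  simp only [asmEnum, map_sum, map_pow, aeval_X]
  refine Finset.sum_congr ?_ fun M _ => prod_entryWeight _ M
  ext M
  rw [mem_fillings]
  refine Iff.trans ?_ (mem_asmFinset (Matrix.of M)).symm
  constructor
  · rintro ⟨h1, h2⟩
    exact ⟨fun i => (walk_iff n _).1.1 (h1 i), fun j => (walk_iff n _).1.1 (h2 j)⟩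
  · rintro ⟨h1, h2⟩
    exact ⟨fun i => (walk_iff n _).1.2 (h1 i), fun j => (walk_iff n _).1.2 (h2 j)⟩

/-! ### Splitting determinants into even and odd parts -/

/-- The change of basis from even and odd parts to values at `s` and `-s`. -/
def pairing (F : Type*) [CommRing F] {k m : ℕ} (ι : Fin m → Fin k) :
    Matrix (Fin k ⊕ Fin m) (Fin k ⊕ Fin m) F :=
  Matrix.fromBlocks 1 (Matrix.of fun a b => if a = ι b then 1 else 0)
    (Matrix.of fun b a => if a = ι b then 1 else 0) (-1)

/-- The Schur complement of the identity block is `-1 - PᵀP`, with `P` the 0-1 matrix of `ι`;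
injectivity of `ι` gives `PᵀP = 1`. -/
theorem det_pairing (F : Type*) [CommRing F] {k m : ℕ} {ι : Fin m → Fin k}
    (hι : Function.Injective ι) : (pairing F ι).det = (-2) ^ m := by
  have h : (-1 - (Matrix.of fun (b : Fin m) (a : Fin k) => if a = ι b then (1 : F) else 0) *
      (Matrix.of fun (a : Fin k) (b : Fin m) => if a = ι b then (1 : F) else 0)) =
      Matrix.diagonal fun _ => -2 := by
    ext i j
    by_cases hij : i = j
    · subst hij; simp [Matrix.mul_apply]; norm_num
    · simp [Matrix.mul_apply, hij, Ne.symm hij, hι.eq_iff]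
  rw [pairing, Matrix.det_fromBlocks_one₁₁, h]
  simp

/-- Values at `s` and `-s` are `E + O` and `E - O`. A node outside the range of `ι` has no negative
partner; in the application it is 0, where odd functions vanish. -/
theorem pairing_mul {F : Type*} [CommRing F] {k m : ℕ} {ι : Fin m → Fin k}
    (hι : Function.Injective ι) {Y : Type*} (E O : Fin k → Y → F)
    (hO : ∀ a, a ∉ Set.range ι → ∀ y, O a y = 0) :
    (Matrix.of fun x y => Sum.elim (fun a => E a y + O a y) (fun b => E (ι b) y - O (ι b) y) x) =
      pairing F ι * Matrix.of fun x y => Sum.elim (fun a => E a y) (fun b => O (ι b) y) x := by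
  ext x y
  rcases x with a | b
  · simp only [pairing, Matrix.mul_apply, Fintype.sum_sum_type, Matrix.of_apply, Sum.elim_inl,
      Sum.elim_inr, Matrix.fromBlocks_apply₁₁, Matrix.fromBlocks_apply₁₂, Matrix.one_apply,
      ite_mul, one_mul, zero_mul, Finset.sum_ite_eq, Finset.mem_univ, if_true]
    congr 1
    by_cases ha : a ∈ Set.range ι
    · obtain ⟨b, rfl⟩ := ha
      simp [hι.eq_iff]
    · rw [hO a ha, Finset.sum_eq_zero]
      intro b _
      rw [if_neg fun h => ha ⟨b, h.symm⟩]
  · simp [pairing, Matrix.mul_apply, Matrix.one_apply, sub_eq_add_neg]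

/-- Changing basis on rows and on columns makes the matrix block diagonal: the kernel has no part
that is even in one variable and odd in the other. -/
theorem det_pairing_kernel {F : Type*} [CommRing F] {k m : ℕ} {ι : Fin m → Fin k}
    (hι : Function.Injective ι) (E O : Fin k → Fin k → F)
    (hO : ∀ a, a ∉ Set.range ι → ∀ a', O a a' = 0)
    (hO' : ∀ a, a ∉ Set.range ι → ∀ a', O a' a = 0) :
    (Matrix.of fun x y => Sum.elim
      (fun a => Sum.elim (fun a' => E a a' + O a a') (fun b' => E a (ι b') - O a (ι b')) y)
      (fun b => Sum.elim (fun a' => E (ι b) a' - O (ι b) a')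
        (fun b' => E (ι b) (ι b') + O (ι b) (ι b')) y) x : Matrix (Fin k ⊕ Fin m) _ F).det =
      (pairing F ι).det ^ 2 * (Matrix.of E).det * (Matrix.of fun b b' => O (ι b) (ι b')).det := by
  have h1 := pairing_mul hι (Y := Fin k ⊕ Fin m) (fun a => Sum.elim (E a) fun b' => E a (ι b'))
    (fun a => Sum.elim (O a) fun b' => -O a (ι b')) (by
      rintro a ha (a' | b') <;> simp [hO a ha])
  have h2 := pairing_mul hι (Y := Fin k ⊕ Fin m) (fun a' => Sum.elim (fun a => E a a') fun _ => 0)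
    (fun a' => Sum.elim (fun _ => 0) fun b => O (ι b) a') (by
      rintro a ha (a' | b') <;> simp [hO' a ha])
  have h3 : (Matrix.of fun x y => Sum.elim (fun a => Sum.elim (E a) (fun b' => E a (ι b')) y)
      (fun b => Sum.elim (O (ι b)) (fun b' => -O (ι b) (ι b')) y) x :
        Matrix (Fin k ⊕ Fin m) (Fin k ⊕ Fin m) F) =
      (pairing F ι * Matrix.of fun x y => Sum.elim
        (fun a' => Sum.elim (fun a => E a a') (fun _ => 0) y)
        (fun b' => Sum.elim (fun _ => 0) (fun b => O (ι b) (ι b')) y) x).transpose := by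
    rw [← h2]
    ext (x | x) (y | y) <;> simp
  have h4 : (Matrix.of fun x y => Sum.elim
        (fun a' => Sum.elim (fun a => E a a') (fun _ => 0) y)
        (fun b' => Sum.elim (fun _ => 0) (fun b => O (ι b) (ι b')) y) x :
          Matrix (Fin k ⊕ Fin m) (Fin k ⊕ Fin m) F) =
      (Matrix.fromBlocks (Matrix.of E) 0 0 (Matrix.of fun b b' => O (ι b) (ι b'))).transpose := by
    ext (x | x) (y | y) <;> simp
  have h0 : (Matrix.of fun x y => Sum.elim
      (fun a => Sum.elim (fun a' => E a a' + O a a') (fun b' => E a (ι b') - O a (ι b')) y)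
      (fun b => Sum.elim (fun a' => E (ι b) a' - O (ι b) a')
        (fun b' => E (ι b) (ι b') + O (ι b) (ι b')) y) x : Matrix (Fin k ⊕ Fin m) _ F) =
      pairing F ι * Matrix.of fun x y => Sum.elim
        (fun a => Sum.elim (E a) (fun b' => E a (ι b')) y)
        (fun b => Sum.elim (O (ι b)) (fun b' => -O (ι b) (ι b')) y) x := by
    rw [← h1]
    ext (x | x) (y | y) <;> simp [sub_eq_add_neg]
  rw [h0, Matrix.det_mul, h3, Matrix.det_transpose, Matrix.det_mul, h4, Matrix.det_transpose,
    Matrix.det_fromBlocks_zero₂₁]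
  ring

/-- The same splitting for monomials, with even powers listed before odd ones. -/
theorem det_pairing_vandermonde {F : Type*} [CommRing F] {k m : ℕ} {ι : Fin m → Fin k}
    (hι : Function.Injective ι) (s : Fin k → F) (hs : ∀ a, a ∉ Set.range ι → s a = 0) :
    (Matrix.of fun x y => Sum.elim s (fun b => -s (ι b)) x ^
      Sum.elim (fun a : Fin k => 2 * (a : ℕ)) (fun b : Fin m => 2 * (b : ℕ) + 1) y :
        Matrix (Fin k ⊕ Fin m) (Fin k ⊕ Fin m) F).det =
      (pairing F ι).det * (Matrix.vandermonde fun a => s a ^ 2).det *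
        ((∏ b, s (ι b)) * (Matrix.vandermonde fun b => s (ι b) ^ 2).det) := by
  have h1 := pairing_mul hι (Y := Fin k ⊕ Fin m)
    (fun a => Sum.elim (fun a' => (s a ^ 2) ^ (a' : ℕ)) fun _ => 0)
    (fun a => Sum.elim (fun _ => 0) fun b' => s a * (s a ^ 2) ^ (b' : ℕ)) (by
      rintro a ha (a' | b') <;> simp [hs a ha])
  have h0 : (Matrix.of fun x y => Sum.elim s (fun b => -s (ι b)) x ^
      Sum.elim (fun a : Fin k => 2 * (a : ℕ)) (fun b : Fin m => 2 * (b : ℕ) + 1) y :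
        Matrix (Fin k ⊕ Fin m) (Fin k ⊕ Fin m) F) = pairing F ι *
      Matrix.fromBlocks (Matrix.vandermonde fun a => s a ^ 2) 0 0
        (Matrix.of fun b b' => s (ι b) * Matrix.vandermonde (fun b => s (ι b) ^ 2) b b') := by
    have h2 : Matrix.fromBlocks (Matrix.vandermonde fun a => s a ^ 2) 0 0
        (Matrix.of fun b b' => s (ι b) * Matrix.vandermonde (fun b => s (ι b) ^ 2) b b') =
        Matrix.of fun x y => Sum.elim
          (fun a => Sum.elim (fun a' : Fin k => (s a ^ 2) ^ (a' : ℕ)) (fun _ => 0) y)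
          (fun b => Sum.elim (fun _ => 0)
            (fun b' : Fin m => s (ι b) * (s (ι b) ^ 2) ^ (b' : ℕ)) y) x := by
      ext (x | x) (y | y) <;> simp [Matrix.vandermonde_apply]
    rw [h2, ← h1]
    ext (x | x) (y | y) <;> simp [pow_mul, pow_add] <;> ring
  rw [h0, Matrix.det_mul, Matrix.det_fromBlocks_zero₂₁, Matrix.det_mul_column]
  ring

/-- Listing the even numbers before the odd ones. -/
theorem exists_parityEquiv {k m : ℕ} (h : k = m ∨ k = m + 1) :
    ∃ e : Fin (k + m) ≃ Fin k ⊕ Fin m, ∀ i,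
      Sum.elim (fun a : Fin k => 2 * (a : ℕ)) (fun b : Fin m => 2 * (b : ℕ) + 1) (e i) = i := by
  let f : Fin k ⊕ Fin m → Fin (k + m) := Sum.elim (fun a => ⟨2 * a, by omega⟩)
    fun b => ⟨2 * b + 1, by omega⟩
  have hf : Function.Injective f := by
    rintro (x | x) (y | y) hxy <;> simp [f] at hxy ⊢ <;> omega
  have hb : Function.Bijective f :=
    (Fintype.bijective_iff_injective_and_card f).2 ⟨hf, by simp⟩
  refine ⟨(Equiv.ofBijective f hb).symm, fun i => ?_⟩
  obtain ⟨x, rfl⟩ := hb.2 i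
  have : (Equiv.ofBijective f hb).symm (f x) = x := (Equiv.ofBijective f hb).symm_apply_apply x
  rw [this]
  rcases x with x | x <;> simp [f]

/-- The denominator of the even and odd kernels. -/
def quad {F : Type*} [CommRing F] (x u v : F) : F := (1 + u + v) ^ 2 - x * u * v

/-- With `U`, `V` as in the proof and `N = 1 + u * V + v * U`, one has `den * U * V = N - 2 * s * t
* U * V`. Multiplying by the conjugate `N + 2 * s * t * U * V` leaves `N² - 4 * u * v * U * V`,
which is `quad`. Thus `s` and `t` survive only in the odd summand, and the denominator has integer
coefficients in `x = -4g²`. -/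
theorem inv_den {F : Type*} [Field F] {g s t u v : F} (hs : s ^ 2 * (1 + (1 + g ^ 2) * u) = u)
    (ht : t ^ 2 * (1 + (1 + g ^ 2) * v) = v) (hq : quad (-4 * g ^ 2) u v ≠ 0) :
    (den g s t)⁻¹ = (1 + (1 + g ^ 2) * u) * ((1 + (1 + g ^ 2) * v) *
        ((1 + u + v + 2 * (1 + g ^ 2) * u * v) / quad (-4 * g ^ 2) u v)) +
      2 * ((s * (1 + (1 + g ^ 2) * u) ^ 2) * ((t * (1 + (1 + g ^ 2) * v) ^ 2) *
        (1 / quad (-4 * g ^ 2) u v))) := by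
  obtain ⟨U, hU⟩ : ∃ U, U = 1 + (1 + g ^ 2) * u := ⟨_, rfl⟩
  obtain ⟨V, hV⟩ : ∃ V, V = 1 + (1 + g ^ 2) * v := ⟨_, rfl⟩
  rw [← hU] at hs ⊢
  rw [← hV] at ht ⊢
  have h1 : den g s t * (U * V) = 1 + u * V + v * U - 2 * (s * t * (U * V)) := by
    simp only [den, wa, wb]
    linear_combination (-(1 + g ^ 2) * (V - (1 + g ^ 2) * (t ^ 2 * V)) + V) * hs +
      (-(1 + g ^ 2) * (U - (1 + g ^ 2) * u) + U) * ht +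
        (V - (1 + g ^ 2) * v) * hU + hV
  have h2 : (s * t) ^ 2 * (U * V) = u * v := by
    linear_combination (t ^ 2 * V) * hs + u * ht
  have h3 : den g s t * (U * (V * (1 + u + v + 2 * (1 + g ^ 2) * u * v)) +
      2 * ((s * U ^ 2) * (t * V ^ 2))) = quad (-4 * g ^ 2) u v := by
    simp only [quad]
    have : den g s t * (U * (V * (1 + u + v + 2 * (1 + g ^ 2) * u * v)) +
      2 * ((s * U ^ 2) * (t * V ^ 2))) = den g s t * (U * V) *
        ((1 + u + v + 2 * (1 + g ^ 2) * u * v) + 2 * (s * t * (U * V))) := by ring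
    rw [this, h1]
    subst hU hV
    linear_combination (-4 * ((1 + (1 + g ^ 2) * u) * (1 + (1 + g ^ 2) * v))) * h2
  generalize quad (-4 * g ^ 2) u v = Q at *
  refine inv_eq_of_mul_eq_one_right ?_
  field_simp
  linear_combination h3

theorem det_mul_column_row {F : Type*} [CommRing F] {k : ℕ} (c : F) (w : Fin k → F)
    (A : Fin k → Fin k → F) :
    (Matrix.of fun i j => c * (w i * (w j * A i j))).det =
      c ^ k * (∏ i, w i) ^ 2 * (Matrix.of A).det := by
  have : (Matrix.of fun i j => c * (w i * (w j * A i j))) =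
      c • Matrix.of fun i j => w i * (Matrix.of fun i j => w j * (Matrix.of A) i j) i j := by
    ext; simp
  rw [this, Matrix.det_smul, Matrix.det_mul_column, Matrix.det_mul_row]
  simp
  ring

/-- Points symmetric under negation. -/
def symm {F : Type*} [CommRing F] {k m : ℕ} (ι : Fin m → Fin k) (s : Fin k → F) :
    Fin k ⊕ Fin m → F :=
  Sum.elim s fun b => -s (ι b)

theorem partition_symm {F : Type*} [Field F] [CharZero F] {g : F} {k m : ℕ}
    {ι : Fin m → Fin k} (hι : Function.Injective ι) (e : Fin (k + m) ≃ Fin k ⊕ Fin m)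
    (he : ∀ i, Sum.elim (fun a : Fin k => 2 * (a : ℕ)) (fun b : Fin m => 2 * (b : ℕ) + 1) (e i) = i)
    (s u : Fin k → F) (hsu : ∀ a, s a ^ 2 * (1 + (1 + g ^ 2) * u a) = u a)
    (hs0 : ∀ a, a ∉ Set.range ι → s a = 0) (hs1 : ∀ b, s (ι b) ≠ 0)
    (hs : Function.Injective (symm ι s))
    (hq : ∀ a a', quad (-4 * g ^ 2) (u a) (u a') ≠ 0)
    (ha : ∀ x y, wa g (symm ι s x) (symm ι s y) ≠ 0)
    (hb : ∀ x y, wb g (symm ι s x) (symm ι s y) ≠ 0)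
    (hg : ∀ x, g + (1 + g ^ 2) * symm ι s x ≠ 0)
    (hρ : ∀ x y, -2 * g * (1 - (1 + g ^ 2) * symm ι s x * symm ι s y) +
      (1 + 2 * g ^ 2) * (symm ι s x - symm ι s y) ≠ 0) :
    partition g (fun i => symm ι s (e i)) (List.ofFn fun i => symm ι s (e i)) (fun _ => false) *
        ((Matrix.vandermonde fun a => s a ^ 2).det ^ 2 *
          (Matrix.vandermonde fun b => s (ι b) ^ 2).det ^ 2) =
      (∏ i, (1 - (1 + g ^ 2) * symm ι s (e i) ^ 2)) *
        (∏ i, ∏ j, den g (symm ι s (e i)) (symm ι s (e j))) *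
        ((∏ a, (1 + (1 + g ^ 2) * u a)) ^ 2 * (Matrix.of fun a a' =>
          (1 + u a + u a' + 2 * (1 + g ^ 2) * u a * u a') / quad (-4 * g ^ 2) (u a) (u a')).det) *
        (2 ^ m * (∏ b, (1 + (1 + g ^ 2) * u (ι b)) ^ 2) ^ 2 *
          (Matrix.of fun b b' => 1 / quad (-4 * g ^ 2) (u (ι b)) (u (ι b'))).det) := by
  have h := partition_eq_det (g := g) (fun i => symm ι s (e i)) (fun i => symm ι s (e i))
    (hs.comp e.injective) (hs.comp e.injective) (fun _ _ => ha _ _) (fun _ _ => hb _ _)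
    (fun _ => hg _) (fun _ _ => hρ _ _)
  -- Nodes and exponents are both reindexed by `e`, so no permutation sign appears.
  have hV : (Matrix.vandermonde fun i => symm ι s (e i)).det =
      (pairing F ι).det * (Matrix.vandermonde fun a => s a ^ 2).det *
        ((∏ b, s (ι b)) * (Matrix.vandermonde fun b => s (ι b) ^ 2).det) := by
    rw [← det_pairing_vandermonde hι s hs0, ← Matrix.det_submatrix_equiv_self e]
    congr 1
    ext i j
    simp only [Matrix.vandermonde_apply, Matrix.submatrix_apply, Matrix.of_apply, he, symm]
  have hK : (Matrix.of fun i j => (den g (symm ι s (e i)) (symm ι s (e j)))⁻¹).det =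
      (pairing F ι).det ^ 2 * ((∏ a, (1 + (1 + g ^ 2) * u a)) ^ 2 * (Matrix.of fun a a' =>
          (1 + u a + u a' + 2 * (1 + g ^ 2) * u a * u a') / quad (-4 * g ^ 2) (u a) (u a')).det) *
        (2 ^ m * ((∏ b, s (ι b)) * ∏ b, (1 + (1 + g ^ 2) * u (ι b)) ^ 2) ^ 2 *
          (Matrix.of fun b b' => 1 / quad (-4 * g ^ 2) (u (ι b)) (u (ι b'))).det) := by
    have h1 := det_mul_column_row 1 (fun a => 1 + (1 + g ^ 2) * u a) fun a a' =>
      (1 + u a + u a' + 2 * (1 + g ^ 2) * u a * u a') / quad (-4 * g ^ 2) (u a) (u a')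
    have h2 := det_mul_column_row 2 (fun b => s (ι b) * (1 + (1 + g ^ 2) * u (ι b)) ^ 2)
      fun b b' => 1 / quad (-4 * g ^ 2) (u (ι b)) (u (ι b'))
    rw [one_pow, one_mul] at h1
    rw [← Finset.prod_mul_distrib, ← h1, ← h2]
    rw [← det_pairing_kernel hι
      (fun a a' => 1 * ((1 + (1 + g ^ 2) * u a) * ((1 + (1 + g ^ 2) * u a') *
        ((1 + u a + u a' + 2 * (1 + g ^ 2) * u a * u a') / quad (-4 * g ^ 2) (u a) (u a')))))
      (fun a a' => 2 * ((s a * (1 + (1 + g ^ 2) * u a) ^ 2) *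
        ((s a' * (1 + (1 + g ^ 2) * u a') ^ 2) * (1 / quad (-4 * g ^ 2) (u a) (u a')))))
      (fun a ha a' => by simp [hs0 a ha]) (fun a ha a' => by simp [hs0 a ha]),
      ← Matrix.det_submatrix_equiv_self e]
    congr 1
    ext i j
    have hsu' : ∀ a, (-s a) ^ 2 * (1 + (1 + g ^ 2) * u a) = u a := fun a => by
      rw [neg_sq, hsu]
    simp only [Matrix.submatrix_apply, Matrix.of_apply]
    rcases e i with a | b <;> rcases e j with a' | b' <;> simp only [symm, Sum.elim_inl, Sum.elim_inr]
    · rw [inv_den (hsu a) (hsu a') (hq a a')]; ring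
    · rw [inv_den (hsu a) (hsu' (ι b')) (hq a (ι b'))]; ring
    · rw [inv_den (hsu' (ι b)) (hsu a') (hq (ι b) a')]; ring
    · rw [inv_den (hsu' (ι b)) (hsu' (ι b')) (hq (ι b) (ι b'))]; ring
  have hU : (pairing F ι).det ≠ 0 := by
    rw [det_pairing F hι]; exact pow_ne_zero _ (by norm_num)
  have hP : ∏ b, s (ι b) ≠ 0 := Finset.prod_ne_zero_iff.2 fun b _ => hs1 b
  rw [hV, hK] at h
  -- The squared Vandermonde determinant and the kernel determinant share the square of `det
  -- (pairing F ι) * ∏ b, s (ι b)`.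
  refine mul_left_cancel₀ (pow_ne_zero 2 (mul_ne_zero hU hP)) ?_
  linear_combination h

/-! ### Coalescing nodes: the homogeneous limit -/

open Filter Topology

theorem tendsto_partition {L : Filter ℝ} (g : ℝ) {n : ℕ} (t : ℝ → Fin n → ℝ)
    (ht : ∀ j, Tendsto (fun ε => t ε j) L (𝓝 0)) (l : List (ℝ → ℝ))
    (hl : ∀ f ∈ l, Tendsto f L (𝓝 0)) (σ : Fin n → Bool) :
    Tendsto (fun ε => partition g (t ε) (l.map fun f => f ε) σ) L
      (𝓝 (partition g (fun _ => 0) (List.replicate l.length 0) σ)) := by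
  have hrow : ∀ (f : ℝ → ℝ), Tendsto f L (𝓝 0) → ∀ (n : ℕ) (t : ℝ → Fin n → ℝ)
      (_ : ∀ j, Tendsto (fun ε => t ε j) L (𝓝 0)) (h : Bool) (σ τ : Fin n → Bool),
      Tendsto (fun ε => row g (f ε) n (t ε) h σ τ) L (𝓝 (row g 0 n (fun _ => 0) h σ τ)) := by
    intro f hf n
    induction n with
    | zero => intro t _ h σ τ; exact tendsto_const_nhds
    | succ n ih =>
      intro t ht h σ τ
      simp only [row]
      refine tendsto_finsetSum _ fun k _ => Tendsto.mul ?_ (ih _ (fun j => ht j.succ) _ _ _)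
      have h0 := ht 0
      have hc : ∀ a b c d, Continuous fun p : ℝ × ℝ => vertex g p.1 p.2 a b c d := by
        intro a b c d
        cases a <;> cases b <;> cases c <;> cases d <;> simp only [vertex, wa, wb] <;> fun_prop
      exact (hc h (σ 0) k (τ 0)).continuousAt.tendsto.comp (hf.prodMk_nhds h0)
  induction l generalizing σ with
  | nil => exact tendsto_const_nhds
  | cons f l ih =>
    simp only [List.map_cons, List.length_cons, List.replicate_succ, partition]
    exact tendsto_finsetSum _ fun τ _ => (hrow f (hl f (by simp)) n t ht _ _ _).mul
      (ih (fun f hf => hl f (by simp [hf])) τ)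

theorem det_vandermonde_smul {F : Type*} [CommRing F] {n : ℕ} (c : F) (v : Fin n → F) :
    (Matrix.vandermonde fun i => c * v i).det =
      (∏ i : Fin n, c ^ (i : ℕ)) * (Matrix.vandermonde v).det := by
  rw [← Matrix.det_mul_row]
  congr 1
  ext i j
  simp [Matrix.vandermonde_apply, mul_pow]

theorem tendsto_det_vandermonde {L : Filter ℝ} {n : ℕ} (v : ℝ → Fin n → ℝ) (x : Fin n → ℝ)
    (h : ∀ i, Tendsto (fun ε => v ε i) L (𝓝 (x i))) :
    Tendsto (fun ε => (Matrix.vandermonde (v ε)).det) L (𝓝 (Matrix.vandermonde x).det) := by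
  have hc : Continuous fun v : Fin n → ℝ => (Matrix.vandermonde v).det := by
    simp only [Matrix.det_vandermonde]
    fun_prop
  exact hc.continuousAt.tendsto.comp (tendsto_pi_nhds.2 h)

/-- Coalescence of the nodes turns a kernel determinant into a determinant of coefficients. -/
theorem tendsto_det_kernel {K T : ℕ} (hT : K ≤ T) (c : ℕ → ℕ → ℝ) (f : ℝ → ℝ → ℝ)
    (x : Fin K → ℝ) (hx : Function.Injective x) (r : Fin K → Fin K → ℝ → ℝ)
    (r₀ : Fin K → Fin K → ℝ) (hr : ∀ i j, Tendsto (r i j) (𝓝[>] 0) (𝓝 (r₀ i j)))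
    (hf : ∀ i j, ∀ᶠ ε in 𝓝[>] 0, f (ε * x i) (ε * x j) =
      ∑ q ∈ Finset.range T ×ˢ Finset.range T, c q.1 q.2 * ((ε * x i) ^ q.1 * (ε * x j) ^ q.2) +
        ε ^ (2 * K) * r i j ε) :
    Tendsto (fun ε => (Matrix.of fun i j => f (ε * x i) (ε * x j)).det /
        (∏ i : Fin K, ε ^ (i : ℕ)) ^ 2) (𝓝[>] 0)
      (𝓝 ((Matrix.vandermonde x).det ^ 2 * (Matrix.of fun k l : Fin K => c k l).det)) := by
  let V := Matrix.vandermonde x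
  have hV : V.det ≠ 0 := Matrix.det_vandermonde_ne_zero_iff.2 hx
  let W := V⁻¹
  have hWV : W * V = 1 := Matrix.nonsing_inv_mul _ (isUnit_iff_ne_zero.2 hV)
  have hVW : V * W = 1 := Matrix.mul_nonsing_inv _ (isUnit_iff_ne_zero.2 hV)
  let ω : Fin K → ℕ → ℝ := fun k k' => ∑ i, W k i * x i ^ k'
  have hω : ∀ (k : Fin K) k', k' < K → ω k k' = if (k : ℕ) = k' then 1 else 0 := by
    intro k k' hk'
    have := congrFun (congrFun hWV k) ⟨k', hk'⟩
    simpa [Matrix.mul_apply, V, Matrix.vandermonde_apply, Matrix.one_apply, Fin.ext_iff] using this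
  -- The inverse Vandermonde matrix on both sides turns values at the nodes into coefficients, up to
  -- terms with extra powers of `ε`. The remainder, of order `ε ^ (2 * K)`, outlasts the division
  -- because `k + l < 2 * K`.
  let G : ℝ → Matrix (Fin K) (Fin K) ℝ := fun ε => Matrix.of fun k l =>
    (∑ p : Fin K × Fin K, W k p.1 * W l p.2 * f (ε * x p.1) (ε * x p.2)) / ε ^ ((k : ℕ) + l)
  have hdet : ∀ ε : ℝ, 0 < ε → (Matrix.of fun i j => f (ε * x i) (ε * x j)).det /
      (∏ i : Fin K, ε ^ (i : ℕ)) ^ 2 = V.det ^ 2 * (G ε).det := by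
    intro ε hε
    have h1 : (W * (Matrix.of fun i j => f (ε * x i) (ε * x j)) * W.transpose) =
        Matrix.of fun k l : Fin K => 1 * (ε ^ (k : ℕ) * (ε ^ (l : ℕ) * G ε k l)) := by
      ext k l
      simp only [G, Matrix.mul_apply, Matrix.of_apply, Matrix.transpose_apply,
        Fintype.sum_prod_type, Finset.sum_mul]
      rw [Finset.sum_comm]
      have : ε ^ (k : ℕ) * (ε ^ (l : ℕ)) = ε ^ ((k : ℕ) + l) := (pow_add _ _ _).symm
      rw [one_mul, ← mul_assoc, this, mul_div_cancel₀ _ (pow_pos hε _).ne']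
      refine Finset.sum_congr rfl fun i _ => Finset.sum_congr rfl fun j _ => ?_
      ring
    have h2 := det_mul_column_row 1 (fun k : Fin K => ε ^ (k : ℕ)) (G ε)
    rw [← h1, Matrix.det_mul, Matrix.det_mul, Matrix.det_transpose, one_pow, one_mul] at h2
    have h3 : V.det * W.det = 1 := by rw [← Matrix.det_mul, hVW, Matrix.det_one]
    have h4 : (∏ i : Fin K, ε ^ (i : ℕ)) ≠ 0 :=
      Finset.prod_ne_zero_iff.2 fun i _ => (pow_pos hε _).ne'
    rw [div_eq_iff (pow_ne_zero _ h4)]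
    change _ = (∏ i : Fin K, ε ^ (i : ℕ)) ^ 2 * (G ε).det at h2
    linear_combination V.det ^ 2 * h2 - (V.det * W.det + 1) *
      (Matrix.of fun i j => f (ε * x i) (ε * x j)).det * h3
  have hG : ∀ k l, Tendsto (fun ε => G ε k l) (𝓝[>] 0) (𝓝 (c k l)) := by
    intro k l
    have hpos : ∀ᶠ ε : ℝ in 𝓝[>] 0, 0 < ε := self_mem_nhdsWithin
    have hall : ∀ᶠ ε in 𝓝[>] 0, ∀ i j, f (ε * x i) (ε * x j) =
      ∑ q ∈ Finset.range T ×ˢ Finset.range T, c q.1 q.2 * ((ε * x i) ^ q.1 * (ε * x j) ^ q.2) +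
        ε ^ (2 * K) * r i j ε :=
      eventually_all.2 fun i => eventually_all.2 fun j => hf i j
    have hε0 : Tendsto (fun ε : ℝ => ε) (𝓝[>] 0) (𝓝 0) := tendsto_nhdsWithin_of_tendsto_nhds tendsto_id
    have heq : ∀ᶠ ε in 𝓝[>] 0, G ε k l =
        ∑ q ∈ Finset.range T ×ˢ Finset.range T,
          c q.1 q.2 * (ω k q.1 * ω l q.2) * (ε ^ (q.1 + q.2) / ε ^ ((k : ℕ) + l)) +
        ∑ p : Fin K × Fin K, W k p.1 * W l p.2 * (ε ^ (2 * K - (k + l)) * r p.1 p.2 ε) := by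
      filter_upwards [hpos, hall] with ε hε hall
      have hsub : ε ^ (2 * K) = ε ^ (2 * K - ((k : ℕ) + l)) * ε ^ ((k : ℕ) + l) := by
        rw [← pow_add]; congr 1; omega
      simp only [G, Matrix.of_apply, hall, mul_add, Finset.sum_add_distrib, add_div]
      congr 1
      · simp only [Finset.mul_sum, Finset.sum_div]
        rw [Finset.sum_comm]
        refine Finset.sum_congr rfl fun q _ => ?_
        simp only [ω]
        rw [Finset.sum_mul_sum, ← Finset.sum_product', Finset.mul_sum, Finset.sum_mul]
        refine Finset.sum_congr rfl fun p _ => ?_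
        rw [pow_add ε q.1 q.2]
        ring
      · rw [Finset.sum_div]
        refine Finset.sum_congr rfl fun p _ => ?_
        rw [hsub]
        field_simp
    have hlim : Tendsto (fun ε : ℝ => ∑ q ∈ Finset.range T ×ˢ Finset.range T,
          c q.1 q.2 * (ω k q.1 * ω l q.2) * (ε ^ (q.1 + q.2) / ε ^ ((k : ℕ) + l)) +
        ∑ p : Fin K × Fin K, W k p.1 * W l p.2 * (ε ^ (2 * K - (k + l)) * r p.1 p.2 ε)) (𝓝[>] 0)
        (𝓝 (∑ q ∈ Finset.range T ×ˢ Finset.range T, (if q = ((k : ℕ), (l : ℕ)) then c k l else 0) +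
          ∑ p : Fin K × Fin K, W k p.1 * W l p.2 * (0 * r₀ p.1 p.2))) := by
      refine Tendsto.add (tendsto_finsetSum _ fun q _ => ?_) (tendsto_finsetSum _ fun p _ => ?_)
      · obtain ⟨k', l'⟩ := q
        dsimp only
        by_cases h0 : ω k k' * ω l l' = 0
        · have : ¬ ((k', l') = ((k : ℕ), (l : ℕ))) := by
            intro h
            simp only [Prod.mk.injEq] at h
            rw [h.1, h.2, hω _ _ k.2, hω _ _ l.2] at h0
            simp at h0
          simp [h0, this]
        · obtain ⟨hk, hl⟩ := mul_ne_zero_iff.1 h0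
          -- `ω k` is the indicator of `k` on exponents below `K`, and exponents from `K` on exceed
          -- `k`. So every surviving term other than (`k`, `l`) has total exponent above `k + l` and
          -- tends to 0.
          have hk' : k' = k ∨ (k : ℕ) < k' := by
            by_cases h : k' < K
            · left; by_contra h'; exact hk (by rw [hω _ _ h, if_neg (Ne.symm h')])
            · right; omega
          have hl' : l' = l ∨ (l : ℕ) < l' := by
            by_cases h : l' < K
            · left; by_contra h'; exact hl (by rw [hω _ _ h, if_neg (Ne.symm h')])
            · right; omega
          by_cases hkl : (k', l') = ((k : ℕ), (l : ℕ))
          · rw [if_pos hkl]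
            simp only [Prod.mk.injEq] at hkl
            obtain ⟨rfl, rfl⟩ := hkl
            refine (tendsto_const_nhds (x := c k l)).congr' ?_
            filter_upwards [hpos] with ε hε
            rw [hω _ _ k.2, hω _ _ l.2, div_self (pow_pos hε _).ne']
            simp
          · rw [if_neg hkl]
            have hlt : (k : ℕ) + l < k' + l' := by
              simp only [Prod.mk.injEq] at hkl
              omega
            have : Tendsto (fun ε : ℝ => c k' l' * (ω k k' * ω l l') *
                ε ^ (k' + l' - ((k : ℕ) + l))) (𝓝[>] 0)
                (𝓝 (c k' l' * (ω k k' * ω l l') * 0 ^ (k' + l' - ((k : ℕ) + l)))) :=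
              (hε0.pow _).const_mul _
            rw [zero_pow (by omega), mul_zero] at this
            refine this.congr' ?_
            filter_upwards [hpos] with ε hε
            rw [eq_div_of_mul_eq (pow_pos hε _).ne' (pow_sub_mul_pow ε hlt.le)]
      · refine Tendsto.const_mul _ (Tendsto.mul ?_ (hr _ _))
        have := hε0.pow (2 * K - ((k : ℕ) + l))
        rwa [zero_pow (by omega)] at this
    rw [Finset.sum_ite_eq' , if_pos (by simp; omega)] at hlim
    simp only [zero_mul, mul_zero, Finset.sum_const_zero, add_zero] at hlim
    exact hlim.congr' (heq.mono fun _ h => h.symm)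
  have hdetG : Tendsto (fun ε => (G ε).det) (𝓝[>] 0)
      (𝓝 (Matrix.of fun k l : Fin K => c k l).det) := by
    have hc : Continuous fun A : Matrix (Fin K) (Fin K) ℝ => A.det := continuous_id.matrix_det
    exact hc.continuousAt.tendsto.comp (tendsto_pi_nhds.2 fun k => tendsto_pi_nhds.2 fun l => hG k l)
  refine (hdetG.const_mul (V.det ^ 2)).congr' ?_
  filter_upwards [self_mem_nhdsWithin] with ε hε
  exact (hdet ε hε).symm

/-! ### Power series coefficients of the two kernels -/

open Filter Topology

/-- `1 - quad X u v` as a polynomial in `u` (inner variable) and `v` (outer variable). -/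
noncomputable def ratio : ℤ[X][X][X] :=
  -(2 * (C X + X) + (C X + X) ^ 2 - C (C X) * C X * X)

/-- Truncated expansion of `1 / quad X u v`. -/
noncomputable def geom (M : ℕ) : ℤ[X][X][X] := ∑ i ∈ Finset.range M, ratio ^ i

/-- Evaluation at real numbers. -/
noncomputable def evalAt (x u v : ℝ) : ℤ[X][X][X] →+* ℝ :=
  eval₂RingHom (eval₂RingHom (aeval x : ℤ[X] →ₐ[ℤ] ℝ).toRingHom u) v

theorem evalAt_inner (x u v : ℝ) : evalAt x u v (C X) = u := by simp [evalAt]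

theorem evalAt_outer (x u v : ℝ) : evalAt x u v X = v := by simp [evalAt]

theorem evalAt_base (x u v : ℝ) : evalAt x u v (C (C X)) = x := by simp [evalAt]

theorem evalAt_sub (x u v : ℝ) (p q : ℤ[X][X][X]) :
    evalAt x u v (p - q) = evalAt x u v p - evalAt x u v q := map_sub (evalAt x u v) p q

theorem evalAt_neg (x u v : ℝ) (p : ℤ[X][X][X]) : evalAt x u v (-p) = -evalAt x u v p :=
  map_neg (evalAt x u v) p

theorem evalAt_ratio (x u v : ℝ) : evalAt x u v ratio = 1 - quad x u v := by
  simp only [ratio, evalAt_neg, evalAt_sub, map_add, map_mul, map_pow, map_ofNat, evalAt_inner,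
    evalAt_outer, evalAt_base, quad]
  ring

theorem one_div_quad {x u v : ℝ} (h : quad x u v ≠ 0) (M : ℕ) :
    1 / quad x u v = evalAt x u v (geom M) + (1 - quad x u v) ^ M / quad x u v := by
  have h1 := geom_sum_mul (1 - quad x u v) M
  rw [geom, map_sum]
  simp only [map_pow, evalAt_ratio]
  field_simp
  linear_combination h1

theorem evalAt_eq_sum (x : ℝ) (p : ℤ[X][X][X]) : ∃ T₀, ∀ T, T₀ ≤ T → ∀ u v,
    evalAt x u v p = ∑ q ∈ Finset.range T ×ˢ Finset.range T,
      aeval x ((p.coeff q.2).coeff q.1) * (u ^ q.1 * v ^ q.2) := by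
  refine ⟨p.natDegree + 1 + ∑ l ∈ Finset.range (p.natDegree + 1), ((p.coeff l).natDegree + 1),
    fun T hT u v => ?_⟩
  have hT1 : p.natDegree < T := by omega
  have hT2 : ∀ l, (p.coeff l).natDegree < T := by
    intro l
    by_cases hl : l < p.natDegree + 1
    · have := Finset.single_le_sum (f := fun l => (p.coeff l).natDegree + 1)
        (fun _ _ => Nat.zero_le _) (Finset.mem_range.2 hl)
      omega
    · rw [coeff_eq_zero_of_natDegree_lt (by omega)]
      simp; omega
  rw [Finset.sum_product_right]
  simp only [evalAt, coe_eval₂RingHom]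
  rw [eval₂_eq_sum_range' _ hT1]
  refine Finset.sum_congr rfl fun l _ => ?_
  rw [coe_eval₂RingHom, eval₂_eq_sum_range' _ (hT2 l), Finset.sum_mul]
  refine Finset.sum_congr rfl fun k _ => ?_
  simp only [AlgHom.toRingHom_eq_coe, RingHom.coe_coe]
  ring

/-- The determinant of coefficients of `N / quad X u v`. -/
noncomputable def coeffDet (N : ℤ[X][X][X]) (K : ℕ) : ℤ[X] :=
  -- Truncation at `2 * K` is harmless: `ratio` has no constant term, and the entries only involve
  -- total degree at most `2 * K - 2`.
  (Matrix.of fun k l : Fin K => ((N * geom (2 * K)).coeff l).coeff k).det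

theorem tendsto_quad (x a b : ℝ) :
    Tendsto (fun ε : ℝ => quad x (ε * a) (ε * b)) (𝓝[>] 0) (𝓝 1) := by
  have h : Continuous fun ε : ℝ => quad x (ε * a) (ε * b) := by
    simp only [quad]; fun_prop
  have := h.tendsto 0
  simp only [quad, zero_mul, mul_zero, add_zero, sub_zero, one_pow] at this
  exact tendsto_nhdsWithin_of_tendsto_nhds this

theorem tendsto_coeffDet {x : ℝ} (N : ℤ[X][X][X]) {K : ℕ}
    (hN : ∀ a b, Continuous fun ε => evalAt x (ε * a) (ε * b) N)
    (z : Fin K → ℝ) (hz : Function.Injective z) :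
    Tendsto (fun ε => (Matrix.of fun i j => evalAt x (ε * z i) (ε * z j) N /
      quad x (ε * z i) (ε * z j)).det / (∏ i : Fin K, ε ^ (i : ℕ)) ^ 2) (𝓝[>] 0)
      (𝓝 ((Matrix.vandermonde z).det ^ 2 * aeval x (coeffDet N K))) := by
  obtain ⟨T₀, hT₀⟩ := evalAt_eq_sum x (N * geom (2 * K))
  have hdet : aeval x (coeffDet N K) =
      (Matrix.of fun k l : Fin K => aeval x (((N * geom (2 * K)).coeff l).coeff k)).det := by
    rw [coeffDet, AlgHom.map_det]
    rfl
  rw [hdet]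
  refine tendsto_det_kernel (T := max T₀ K) (le_max_right _ _)
    (fun k l => aeval x (((N * geom (2 * K)).coeff l).coeff k))
    (fun u v => evalAt x u v N / quad x u v) z hz
    (fun i j ε => evalAt x (ε * z i) (ε * z j) N *
      (-(2 * (z i + z j) + ε * (z i + z j) ^ 2 - x * z i * (ε * z j))) ^ (2 * K) /
        quad x (ε * z i) (ε * z j))
    (fun i j => evalAt x (0 * z i) (0 * z j) N *
      (-(2 * (z i + z j) + 0 * (z i + z j) ^ 2 - x * z i * (0 * z j))) ^ (2 * K) / 1)
    (fun i j => ?_) (fun i j => ?_)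
  · refine Tendsto.div (tendsto_nhdsWithin_of_tendsto_nhds ?_) (tendsto_quad x _ _) one_ne_zero
    exact ((hN (z i) (z j)).mul (by fun_prop : Continuous fun ε : ℝ =>
      (-(2 * (z i + z j) + ε * (z i + z j) ^ 2 - x * z i * (ε * z j))) ^ (2 * K))).tendsto 0
  · filter_upwards [(tendsto_quad x (z i) (z j)).eventually_ne one_ne_zero] with ε hε
    rw [← hT₀ _ (le_max_left _ _), div_eq_mul_one_div, one_div_quad hε (2 * K), map_mul]
    -- One factor `ε` comes out of `1 - quad`, so the tail of the geometric series is of order `ε ^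
    -- (2 * K)`.
    have : 1 - quad x (ε * z i) (ε * z j) =
        ε * -(2 * (z i + z j) + ε * (z i + z j) ^ 2 - x * z i * (ε * z j)) := by
      simp only [quad]; ring
    rw [this, mul_pow]
    ring

/-- Twice the numerator of the even kernel. -/
noncomputable def evenNumerator : ℤ[X][X][X] :=
  -- In terms of `x = -4g²` the coefficient `2 * (1 + g ^ 2)` is `2 - x / 2`; doubling makes it
  -- integral.
  2 * (1 + C X + X) + (4 - C (C X)) * C X * X

theorem evalAt_evenNumerator (x u v : ℝ) :
    evalAt x u v evenNumerator = 2 * (1 + u + v) + (4 - x) * u * v := by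
  simp only [evenNumerator, evalAt_sub, map_add, map_mul, map_ofNat, map_one, evalAt_inner,
    evalAt_outer, evalAt_base]

/-- The homogeneous limit of the factored determinant formula. -/
theorem aeval_asmEnum {g : ℝ} (hg : 0 < g) {k m : ℕ} (hkm : k = m ∨ k = m + 1)
    {ι : Fin m → Fin k} (hι : Function.Injective ι) (z : Fin k → ℝ) (hz : Function.Injective z)
    (hz0 : ∀ a, 0 ≤ z a) (hz1 : ∀ b, 0 < z (ι b)) (hz2 : ∀ a, a ∉ Set.range ι → z a = 0) :
    2 ^ k * aeval (-4 * g ^ 2) (asmEnum (k + m)) =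
      2 ^ m * aeval (-4 * g ^ 2) (coeffDet evenNumerator k) *
        aeval (-4 * g ^ 2) (coeffDet 1 m) := by
  obtain ⟨e, he⟩ := exists_parityEquiv hkm
  -- Chosen so that the nodes satisfy `s ^ 2 = ε * y` while the kernel variable `u` is exactly `ε *
  -- z`.
  let y : ℝ → Fin k → ℝ := fun ε a => z a / (1 + (1 + g ^ 2) * (ε * z a))
  let s : ℝ → Fin k → ℝ := fun ε a => √(ε * y ε a)
  have hpos : ∀ᶠ ε : ℝ in 𝓝[>] 0, 0 < ε := self_mem_nhdsWithin
  have hε0 : Tendsto (fun ε : ℝ => ε) (𝓝[>] 0) (𝓝 0) :=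
    tendsto_nhdsWithin_of_tendsto_nhds tendsto_id
  have hden : ∀ a, Tendsto (fun ε => 1 + (1 + g ^ 2) * (ε * z a)) (𝓝[>] 0) (𝓝 1) := fun a => by
    have : Continuous fun ε => 1 + (1 + g ^ 2) * (ε * z a) := by fun_prop
    simpa using tendsto_nhdsWithin_of_tendsto_nhds (this.tendsto 0)
  have hdpos : ∀ ε, 0 < ε → ∀ a, 0 < 1 + (1 + g ^ 2) * (ε * z a) := fun ε hε a => by
    have := hz0 a; positivity
  have hy : ∀ a, Tendsto (fun ε => y ε a) (𝓝[>] 0) (𝓝 (z a)) := fun a => by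
    have := (tendsto_const_nhds (x := z a)).div (hden a) one_ne_zero
    rw [div_one] at this
    exact this
  have hs : ∀ a, Tendsto (fun ε => s ε a) (𝓝[>] 0) (𝓝 0) := fun a => by
    have := (Real.continuous_sqrt.tendsto _).comp (hε0.mul (hy a))
    rw [zero_mul, Real.sqrt_zero] at this
    exact this
  have hS : ∀ x, Tendsto (fun ε => symm ι (s ε) x) (𝓝[>] 0) (𝓝 0) := by
    rintro (a | b)
    · exact hs a
    · simpa [symm] using (hs (ι b)).neg
  have hynn : ∀ ε, 0 < ε → ∀ a, 0 ≤ y ε a := fun ε hε a =>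
    div_nonneg (hz0 a) (hdpos ε hε a).le
  have hs2 : ∀ ε, 0 < ε → ∀ a, s ε a ^ 2 = ε * y ε a := fun ε hε a =>
    Real.sq_sqrt (mul_nonneg hε.le (hynn ε hε a))
  have hsu : ∀ ε, 0 < ε → ∀ a, s ε a ^ 2 * (1 + (1 + g ^ 2) * (ε * z a)) = ε * z a :=
    fun ε hε a => by
      rw [hs2 ε hε]
      have := (hdpos ε hε a).ne'
      rw [mul_assoc, div_mul_cancel₀ _ this]
  have hspos : ∀ ε, 0 < ε → ∀ b, 0 < s ε (ι b) := fun ε hε b =>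
    Real.sqrt_pos.2 (mul_pos hε (div_pos (hz1 b) (hdpos ε hε _)))
  have hs0 : ∀ ε a, a ∉ Set.range ι → s ε a = 0 := fun ε a ha => by
    simp [s, y, hz2 a ha]
  have hsinj : ∀ ε, 0 < ε → Function.Injective (s ε) := fun ε hε a a' h => by
    have h1 := hsu ε hε a
    have h2 := hsu ε hε a'
    rw [h] at h1
    apply hz
    have h3 : ε * (z a - z a') = 0 := by
      linear_combination (-(1 + (1 + g ^ 2) * (ε * z a'))) * h1 + (1 + (1 + g ^ 2) * (ε * z a)) * h2
    rcases mul_eq_zero.1 h3 with h4 | h4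
    · exact absurd h4 hε.ne'
    · linarith
  have hSinj : ∀ ε, 0 < ε → Function.Injective (symm ι (s ε)) := by
    intro ε hε
    rintro (a | b) (a' | b') h <;> simp only [symm, Sum.elim_inl, Sum.elim_inr] at h
    · rw [hsinj ε hε h]
    · have := hspos ε hε b'
      have : 0 ≤ s ε a := Real.sqrt_nonneg _
      linarith
    · have := hspos ε hε b
      have : 0 ≤ s ε a' := Real.sqrt_nonneg _
      linarith
    · rw [hι (hsinj ε hε (neg_injective h))]
  have hpair : ∀ (φ : ℝ → ℝ → ℝ), Continuous (Function.uncurry φ) → ∀ x y,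
      Tendsto (fun ε => φ (symm ι (s ε) x) (symm ι (s ε) y)) (𝓝[>] 0) (𝓝 (φ 0 0)) :=
    fun φ hφ x y => (hφ.tendsto (0, 0)).comp ((hS x).prodMk_nhds (hS y))
  have hwa : Continuous (Function.uncurry (wa g)) := by
    unfold wa Function.uncurry; fun_prop
  have hwb : Continuous (Function.uncurry (wb g)) := by
    unfold wb Function.uncurry; fun_prop
  have hdn : Continuous (Function.uncurry (den g)) := hwa.mul hwb
  have hgc : Continuous (Function.uncurry fun s _ : ℝ => g + (1 + g ^ 2) * s) := by
    unfold Function.uncurry; fun_prop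
  have hρc : Continuous (Function.uncurry fun s s' : ℝ =>
      -2 * g * (1 - (1 + g ^ 2) * s * s') + (1 + 2 * g ^ 2) * (s - s')) := by
    unfold Function.uncurry; fun_prop
  have hne : ∀ (φ : ℝ → ℝ → ℝ), Continuous (Function.uncurry φ) → φ 0 0 ≠ 0 →
      ∀ᶠ ε in 𝓝[>] 0, ∀ x y, φ (symm ι (s ε) x) (symm ι (s ε) y) ≠ 0 :=
    fun φ hφ h0 => eventually_all.2 fun x => eventually_all.2 fun y =>
      (hpair φ hφ x y).eventually_ne h0
  have hqne : ∀ᶠ ε in 𝓝[>] 0, ∀ a a', quad (-4 * g ^ 2) (ε * z a) (ε * z a') ≠ 0 :=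
    eventually_all.2 fun a => eventually_all.2 fun a' =>
      (tendsto_quad _ (z a) (z a')).eventually_ne one_ne_zero
  let A : ℝ → ℝ := fun ε => partition g (fun i => symm ι (s ε) (e i))
    (List.ofFn fun i => symm ι (s ε) (e i)) (fun _ => false)
  let P : ℝ → ℝ := fun ε => (∏ i, (1 - (1 + g ^ 2) * symm ι (s ε) (e i) ^ 2)) *
    (∏ i, ∏ j, den g (symm ι (s ε) (e i)) (symm ι (s ε) (e j))) *
    (∏ a, (1 + (1 + g ^ 2) * (ε * z a))) ^ 2 * (∏ b, (1 + (1 + g ^ 2) * (ε * z (ι b))) ^ 2) ^ 2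
  -- The factor `2 ^ k` compensates for the doubled even numerator; `2 ^ m` comes from the `2` in
  -- the odd kernel. The powers of `ε` from the Vandermonde determinants become the denominators on
  -- the right.
  have hkey : ∀ᶠ ε in 𝓝[>] 0, 2 ^ k * A ε * ((Matrix.vandermonde (y ε)).det ^ 2 *
      (Matrix.vandermonde fun b => y ε (ι b)).det ^ 2) = 2 ^ m * P ε *
      ((Matrix.of fun i j => evalAt (-4 * g ^ 2) (ε * z i) (ε * z j) evenNumerator /
        quad (-4 * g ^ 2) (ε * z i) (ε * z j)).det / (∏ i : Fin k, ε ^ (i : ℕ)) ^ 2) *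
      ((Matrix.of fun i j => evalAt (-4 * g ^ 2) (ε * z (ι i)) (ε * z (ι j)) 1 /
        quad (-4 * g ^ 2) (ε * z (ι i)) (ε * z (ι j))).det / (∏ i : Fin m, ε ^ (i : ℕ)) ^ 2) := by
    filter_upwards [hpos, hqne, hne _ hwa (by simp [wa]), hne _ hwb (by simp [wb]),
      hne _ hgc (by simpa using hg.ne'), hne _ hρc (by simpa using hg.ne')]
      with ε hε hq ha hb hgn hρ
    have h := partition_symm hι e he (s ε) (fun a => ε * z a) (hsu ε hε) (hs0 ε)
      (fun b => (hspos ε hε b).ne') (hSinj ε hε) hq ha hb (fun x => hgn x x) hρ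
    simp only [hs2 ε hε] at h
    rw [det_vandermonde_smul, det_vandermonde_smul] at h
    have hE : (Matrix.of fun i j => evalAt (-4 * g ^ 2) (ε * z i) (ε * z j) evenNumerator /
        quad (-4 * g ^ 2) (ε * z i) (ε * z j)).det = 2 ^ k * (Matrix.of fun a a' =>
          (1 + ε * z a + ε * z a' + 2 * (1 + g ^ 2) * (ε * z a) * (ε * z a')) /
            quad (-4 * g ^ 2) (ε * z a) (ε * z a')).det := by
      have h1 := det_mul_column_row 2 (fun _ : Fin k => 1) fun a a' =>
          (1 + ε * z a + ε * z a' + 2 * (1 + g ^ 2) * (ε * z a) * (ε * z a')) /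
            quad (-4 * g ^ 2) (ε * z a) (ε * z a')
      simp only [Finset.prod_const_one, one_pow, mul_one] at h1
      rw [← h1]
      congr 1
      ext i j
      simp only [evalAt_evenNumerator, Matrix.of_apply]
      ring
    have h1 : (∏ i : Fin k, ε ^ (i : ℕ)) ≠ 0 :=
      Finset.prod_ne_zero_iff.2 fun i _ => (pow_pos hε _).ne'
    have h2 : (∏ i : Fin m, ε ^ (i : ℕ)) ≠ 0 :=
      Finset.prod_ne_zero_iff.2 fun i _ => (pow_pos hε _).ne'
    simp only [map_one]
    rw [hE]
    simp only [A, P]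
    generalize (∏ i : Fin k, ε ^ (i : ℕ)) = p₁ at *
    generalize (∏ i : Fin m, ε ^ (i : ℕ)) = p₂ at *
    generalize (Matrix.of fun a a' =>
      (1 + ε * z a + ε * z a' + 2 * (1 + g ^ 2) * (ε * z a) * (ε * z a')) /
        quad (-4 * g ^ 2) (ε * z a) (ε * z a')).det = d₁ at *
    generalize (Matrix.of fun b b' =>
      1 / quad (-4 * g ^ 2) (ε * z (ι b)) (ε * z (ι b'))).det = d₂ at *
    generalize (∏ a, (1 + (1 + g ^ 2) * (ε * z a))) = q₁ at *
    generalize (∏ b, (1 + (1 + g ^ 2) * (ε * z (ι b))) ^ 2) = q₂ at *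
    field_simp
    linear_combination h
  have hA : Tendsto A (𝓝[>] 0) (𝓝 (aeval (-4 * g ^ 2) (asmEnum (k + m)))) := by
    have := tendsto_partition g (fun ε i => symm ι (s ε) (e i)) (fun i => hS (e i))
      (List.ofFn fun i ε => symm ι (s ε) (e i)) (fun f hf => by
        obtain ⟨i, rfl⟩ := (List.mem_ofFn' _ _).1 hf
        exact hS (e i)) (fun _ => false)
    rw [List.length_ofFn, partition_zero_eq_aeval] at this
    simpa only [List.map_ofFn, Function.comp_def] using this
  have hP : Tendsto P (𝓝[>] 0) (𝓝 1) := by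
    have h1 : Tendsto P (𝓝[>] 0) (𝓝 ((∏ i : Fin (k + m), (1 - (1 + g ^ 2) * 0 ^ 2)) *
      (∏ i : Fin (k + m), ∏ j : Fin (k + m), den g 0 0) * (∏ a : Fin k, 1) ^ 2 *
        (∏ b : Fin m, 1 ^ 2) ^ 2)) := by
      refine Tendsto.mul (Tendsto.mul (Tendsto.mul ?_ ?_) ?_) ?_
      · exact tendsto_finsetProd _ fun i _ => (((hS (e i)).pow 2).const_mul _).const_sub _
      · exact tendsto_finsetProd _ fun i _ => tendsto_finsetProd _ fun j _ =>
          hpair _ hdn (e i) (e j)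
      · exact (tendsto_finsetProd _ fun a _ => hden a).pow 2
      · exact (tendsto_finsetProd _ fun b _ => (hden (ι b)).pow 2).pow 2
    simpa [den, wa, wb] using h1
  have hl := ((hA.const_mul (2 ^ k)).mul (((tendsto_det_vandermonde y z hy).pow 2).mul
    ((tendsto_det_vandermonde (fun ε b => y ε (ι b)) (fun b => z (ι b)) fun b => hy (ι b)).pow 2)))
  have hr := ((hP.const_mul (2 ^ m)).mul (tendsto_coeffDet (x := -4 * g ^ 2) evenNumerator
    (fun a b => by simp only [evalAt_evenNumerator]; fun_prop) z hz)).mul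
      (tendsto_coeffDet (x := -4 * g ^ 2) 1 (fun a b => by simp only [map_one]; fun_prop)
        (fun b => z (ι b)) (hz.comp hι))
  have huniq := tendsto_nhds_unique (hl.congr' hkey) hr
  have hV1 : (Matrix.vandermonde z).det ≠ 0 := Matrix.det_vandermonde_ne_zero_iff.2 hz
  have hV2 : (Matrix.vandermonde fun b => z (ι b)).det ≠ 0 :=
    Matrix.det_vandermonde_ne_zero_iff.2 (hz.comp hι)
  refine mul_right_cancel₀ (pow_ne_zero 2 (mul_ne_zero hV1 hV2)) ?_
  linear_combination huniq

theorem asmEnum_eq {k m : ℕ} (hkm : k = m ∨ k = m + 1) :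
    2 ^ k * asmEnum (k + m) = 2 ^ m * coeffDet evenNumerator k * coeffDet 1 m := by
  have key : ∀ g : ℝ, 0 < g → 2 ^ k * aeval (-4 * g ^ 2) (asmEnum (k + m)) =
      2 ^ m * aeval (-4 * g ^ 2) (coeffDet evenNumerator k) *
        aeval (-4 * g ^ 2) (coeffDet 1 m) := by
    intro g hg
    rcases hkm with rfl | rfl
    · refine aeval_asmEnum hg (Or.inl rfl) (ι := id) Function.injective_id
        (fun a => (a : ℝ) + 1) ?_ ?_ ?_ ?_
      · intro a b h
        simpa [Fin.ext_iff] using h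
      · intro a; positivity
      · intro a; positivity
      · intro a ha; simp at ha
    -- For odd size the unpaired node is 0, and `Fin.succ` lists the others.
    · refine aeval_asmEnum hg (Or.inr rfl) (ι := Fin.succ) (Fin.succ_injective _)
        (fun a => (a : ℕ)) ?_ ?_ ?_ ?_
      · intro a b h
        simpa [Fin.ext_iff] using h
      · intro a; positivity
      · intro a; simp; positivity
      · intro a ha
        have : a = 0 := by
          by_contra h
          exact ha (Fin.exists_succ_eq.2 h)
        simp [this]
  have hinj : Function.Injective (Polynomial.map (Int.castRingHom ℝ)) :=
    map_injective _ Int.cast_injective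
  apply hinj
  refine eq_of_infinite_eval_eq _ _ ?_
  -- Values of `-4 * g ^ 2` at positive integers `g` are already infinitely many.
  have hinf : (Set.range fun n : ℕ => -4 * ((n : ℝ) + 1) ^ 2).Infinite := by
    refine Set.infinite_range_of_injective fun a b h => ?_
    have h1 : ((a : ℝ) + 1) ^ 2 = ((b : ℝ) + 1) ^ 2 := by
      have : -4 * ((a : ℝ) + 1) ^ 2 = -4 * ((b : ℝ) + 1) ^ 2 := h
      linarith
    have h2 := (pow_left_inj₀ (by positivity) (by positivity) two_ne_zero).1 h1
    exact_mod_cast add_right_cancel h2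
  refine hinf.mono ?_
  rintro _ ⟨n, rfl⟩
  have h := key (n + 1) (by positivity)
  simp only [aeval_def, eval₂_eq_eval_map, algebraMap_int_eq] at h
  simpa [eval_mul, eval_pow] using h

/-! ### The factor 2 and the sequence B -/

/-- The even-indexed factor: the first row of the coefficient matrix is halved. -/
noncomputable def evenFactor (K : ℕ) : ℤ[X] :=
  (Matrix.of fun k l : Fin K => (((if (k : ℕ) = 0 then 1 + C X + X else evenNumerator) *
    geom (2 * K)).coeff l).coeff k).det

/-- In `evenNumerator` the only term without an explicit factor 2 is divisible by the inner
variable, so it does not reach row 0, and a 2 comes out of that row. Size `K + 1` ensures that the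
row exists. -/
theorem coeffDet_evenNumerator (K : ℕ) :
    coeffDet evenNumerator (K + 1) = 2 * evenFactor (K + 1) := by
  have h : (∏ k : Fin (K + 1), if (k : ℕ) = 0 then (2 : ℤ[X]) else 1) = 2 := by
    simp
  rw [coeffDet, evenFactor]
  refine Eq.trans ?_ (congrArg (· * _) h)
  rw [← Matrix.det_mul_column]
  congr 1
  ext1 k l
  simp only [Matrix.of_apply]
  by_cases hk : (k : ℕ) = 0
  · simp only [hk, if_true]
    have : evenNumerator * geom (2 * (K + 1)) = 2 * ((1 + C X + X) * geom (2 * (K + 1))) +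
        C X * (X * ((4 - C (C X)) * geom (2 * (K + 1)))) := by
      rw [evenNumerator]; ring
    rw [this, coeff_add, coeff_add, coeff_C_mul, mul_coeff_zero, coeff_X_zero, zero_mul, add_zero,
      ← C_ofNat, coeff_C_mul, ← C_ofNat, coeff_C_mul]
  · simp [hk]

end SixVertex

theorem theorem3 :
    ∃ B : ℕ → ℤ[X], ∀ n : ℕ, 1 ≤ n →
      (Odd n → asmEnum n = B n * B (n + 1)) ∧
      (Even n → asmEnum n = 2 * B n * B (n + 1)) := by
  -- For n = 2m + 1 the even and odd kernels have sizes m + 1 and m, giving B(n+1) and B(n). For n =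
  -- 2m both sizes are m, giving B(n) and B(n+1); here the 2 from row 0 is not absorbed by `2 ^ k /
  -- 2 ^ m`.
  refine ⟨fun n => if Even n then SixVertex.evenFactor (n / 2)
    else SixVertex.coeffDet 1 (n / 2), fun n hn => ⟨?_, ?_⟩⟩
  · rintro ⟨m, rfl⟩
    have h := SixVertex.asmEnum_eq (k := m + 1) (m := m) (Or.inr rfl)
    rw [SixVertex.coeffDet_evenNumerator] at h
    have h1 : ¬ Even (2 * m + 1) := by simp
    have h2 : Even (2 * m + 1 + 1) := ⟨m + 1, by ring⟩
    have h3 : (2 * m + 1) / 2 = m := by omega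
    have h4 : (2 * m + 1 + 1) / 2 = m + 1 := by omega
    have h5 : m + 1 + m = 2 * m + 1 := by ring
    simp only [h1, h2, h3, h4, if_true, if_false]
    rw [h5] at h
    refine mul_left_cancel₀ (pow_ne_zero (m + 1) (two_ne_zero (α := ℤ[X]))) ?_
    rw [h]; ring
  · rintro ⟨m, rfl⟩
    obtain ⟨m, rfl⟩ : ∃ k, m = k + 1 := ⟨m - 1, by omega⟩
    have h := SixVertex.asmEnum_eq (k := m + 1) (m := m + 1) (Or.inl rfl)
    rw [SixVertex.coeffDet_evenNumerator] at h
    have h1 : Even (m + 1 + (m + 1)) := ⟨_, rfl⟩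
    have h2 : ¬ Even (m + 1 + (m + 1) + 1) := by
      simp [Nat.even_add_one]
    have h3 : (m + 1 + (m + 1)) / 2 = m + 1 := by omega
    have h4 : (m + 1 + (m + 1) + 1) / 2 = m + 1 := by omega
    simp only [h1, h2, h3, h4, if_true, if_false]
    refine mul_left_cancel₀ (pow_ne_zero (m + 1) (two_ne_zero (α := ℤ[X]))) ?_
    rw [h]; ring
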